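/- Let $G$ be a countable discrete group with neutral element $id$ and a left-invariant metric $d$. For a probability measure $\mu$ on $G$ let $X_1,X_2,\dots$ be, under $\mathbb P^\mu$, independent with law $\mu$; put $Z_0=id$, $Z_n=X_1\cdots X_n$, and write $\mathbb E^\mu$ for the expectation. If $\sum_x d(id,x)\mu(x)<\infty$, the rate of escape is $\ell(\mu;d)=\lim_{n\to\infty}\frac1n\mathbb E^\mu[d(id,Z_n)]$. Let $(x,y)_w=\frac12(d(w,x)+d(w,y)-d(x,y))$. For $p>0$, $\mu$ satisfies the $p$-th-moment deviation inequality with constant $\tau<\infty$ if $\mathbb E^\mu[(id,Z_{n+m})_{Z_n}^p]\le\tau$ for all $n,m\in\mathbb N$. Let $B\subseteq G$ and let $\mathcal P(B)$ be the set of probability measures with support equal to $B$. Then $\mu\in\mathcal P(B)$ satisfies the locally uniform $p$-th-moment deviation inequality if, for some $K>0$ and $\tau<\infty$, every $\mu_0\in\mathcal P(B)$ with $\sup_{a\in B}\big(\max\big(\frac{\mu_0(a)}{\mu(a)},\frac{\mu(a)}{\mu_0(a)}\big)-1\big)\le K$ satisfies the $p$-th-moment deviation inequality with constant $\tau$. Theorem.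 Let $\mu\in\mathcal P(B)$. Assume that $\sum_{x}d(id,x)^2\mu(x)<\infty$, that $\mu$ satisfies the second-moment deviation inequality (with some constant), and that $\mu$ satisfies the locally uniform first-moment deviation inequality. Let $(\mu_t)_{t\in[0,1]}$ be a curve in $\mathcal P(B)$ with $\mu_0=\mu$ such that, for every $a\in B$, the function $t\mapsto\log\mu_t(a)$ has a (one-sided) derivative $\nu(a)$ at $t=0$; assume that $\nu$ is bounded on $B$ and that $$\sup_{t\in(0,1]}\sup_{a\in B}\Big|\frac1t\log\frac{\mu_t(a)}{\mu_0(a)}-\nu(a)\Big|<\infty .$$ Then $\mathbb E^{\mu_t}[d(id,Z_n)]$ is finite for all $n$ and the limit defining $\ell(\mu_t;d)$ exists for every $t\in[0,1]$; the variables $d(id,Z_n)\sum_{j=1}^n\nu(X_j)$ are $\mathbb P^\mu$-integrable; and the two limits $$\sigma(\nu,\mu;d):=\lim_{n\to\infty}\frac1n\,\mathbb E^\mu\Big[d(id,Z_n)\sum_{j=1}^n\nu(X_j)\Big]\qquad\text{and}\qquad\lim_{t\to0^+}\frac1t\big(\ell(\mu_t;d)-\ell(\mu;d)\big)$$ exist,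 are finite, and are equal. -/

import Mathlib

open MeasureTheory Filter Topology
open scoped ENNReal NNReal

namespace RandomWalk

/-- The position `Z n` of the trajectory with increments `ω 0, ω 1, …`. The sample space is
`ℕ → G`, whose coordinates are numbered from `0`: the increment `X_j` of the walk, `j ≥ 1`, is
the coordinate `ω (j - 1)`. -/
def Z {G : Type*} [Group G] : ℕ → (ℕ → G) → G
  | 0, _ => 1
  | n + 1, ω => Z n ω * ω n

/-- The law of the sequence of increments: the infinite product of copies of `μ`. -/
noncomputable def pathMeasure {G : Type*} [MeasurableSpace G] (μ : PMF G) : Measure (ℕ → G) :=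
  Measure.infinitePi (fun _ : ℕ => μ.toMeasure)

/-- The Gromov product of `x` and `y` with respect to the reference point `w`. -/
noncomputable def gromovProd {G : Type*} [MetricSpace G] (x y w : G) : ℝ :=
  (dist w x + dist w y - dist x y) / 2

/-- The rate of escape: the limit of the mean distance to the identity at time `n`, divided
by `n`. -/
noncomputable def rateOfEscape {G : Type*} [Group G] [MetricSpace G] [MeasurableSpace G]
    (μ : PMF G) : ℝ :=
  limUnder atTop (fun n : ℕ => (1 / (n : ℝ)) * ∫ ω, dist (1 : G) (Z n ω) ∂(pathMeasure μ))

/-- `μ` has a finite `p`-th moment with respect to the metric. -/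
def HasFiniteMoment {G : Type*} [Group G] [MetricSpace G] (p : ℝ) (μ : PMF G) : Prop :=
  Summable (fun x : G => dist (1 : G) x ^ p * (μ x).toReal)

/-- The `p`-th-moment deviation inequality with the constant `τ`. The expectation is that of a
non-negative quantity and takes values in `[0, ∞]`. -/
def DeviationWith {G : Type*} [Group G] [MetricSpace G] [MeasurableSpace G]
    (p : ℝ) (τ : ℝ≥0) (μ : PMF G) : Prop :=
  ∀ n m : ℕ,
    ∫⁻ ω, ENNReal.ofReal (gromovProd (1 : G) (Z (n + m) ω) (Z n ω) ^ p) ∂(pathMeasure μ) ≤ τ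

/-- The `p`-th-moment deviation inequality. -/
def Deviation {G : Type*} [Group G] [MetricSpace G] [MeasurableSpace G]
    (p : ℝ) (μ : PMF G) : Prop :=
  ∃ τ : ℝ≥0, DeviationWith p τ μ

/-- `sup_{a ∈ B} (max (μ₀ a / μ₁ a) (μ₁ a / μ₀ a) - 1)`, with values in `[0, ∞]`, for measures
`μ₀` and `μ₁` with support `B`. -/
noncomputable def supRatio {G : Type*} (B : Set G) (μ₀ μ₁ : PMF G) : ℝ≥0∞ :=
  ⨆ a ∈ B, (max (μ₀ a / μ₁ a) (μ₁ a / μ₀ a) - 1)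

/-- The neighbourhood of radius `K` of `μ` among the probability measures that have the same
support as `μ`. -/
def nhd {G : Type*} (μ : PMF G) (K : ℝ) : Set (PMF G) :=
  {μ₀ | μ₀.support = μ.support ∧ supRatio μ.support μ₀ μ ≤ ENNReal.ofReal K}

/-- The locally uniform `p`-th-moment deviation inequality. -/
def LocallyUniformDeviation {G : Type*} [Group G] [MetricSpace G] [MeasurableSpace G]
    (p : ℝ) (μ : PMF G) : Prop :=
  ∃ K : ℝ, 0 < K ∧ ∃ τ : ℝ≥0, ∀ μ₀ ∈ nhd μ K, DeviationWith p τ μ₀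

end RandomWalk

/-! Cut a trajectory at time `n`: by left invariance its length at time `n + m` is the sum of the
lengths of two independent walks, minus twice a Gromov product (`dist_Z_concat`,
`measurePreserving_concat`). The deviation inequalities say that this defect is bounded in the mean
or in the mean square, so everything below is additive up to a controlled error.

The first moment gives `|E d(1, Z n) - n ℓ| ≤ 2τ` with a constant that is uniform near `μ`
(`abs_meanDist_sub_le`). The second moment gives a variance of order `n`
(`exists_sqrt_variance_le`), and shows that the covariance of the distance with the centred sum of
`ν` is additive up to `O(√n)`, so that it grows linearly, at rate `σ`
(`exists_tendsto_integral_dist_Z_mul_incSum`).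

For the derivative, write the density of `γ t` as `1 + t φ`, where `φ` depends on `t` and tends to
`ν`. The mean distance under `γ t` is an expectation under `μ` weighted by `∏ (1 + t φ(X_j))`. This
weight is `1 + t ∑ φ(X_j)` up to an error `O(n t²)` in `L²` (`integral_incProd_sub_sq_le`).
Cauchy–Schwarz against the centred distance, of size `√n`, and division by `t n` bound the gap
between the slope of `ℓ` and the normalised covariance at time `n` by `O(1/(t n)) + O(t √n) + O(‖φ -
ν‖₂)` (`abs_rateOfEscape_slope_sub_le`). All three terms vanish when `n` is of order `t ^ (-3/2)`.
-/

namespace RandomWalk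

/-! ### Cauchy–Schwarz and Minkowski in `L²`. -/

section SquareIntegrable

variable {Ω : Type*} [MeasurableSpace Ω] {P : Measure Ω}

theorem integral_add_mul_sq {f g : Ω → ℝ} (hf : MemLp f 2 P) (hg : MemLp g 2 P) (x : ℝ) :
    ∫ ω, (f ω + x * g ω) ^ 2 ∂P =
      ∫ ω, f ω ^ 2 ∂P + 2 * x * ∫ ω, f ω * g ω ∂P + x ^ 2 * ∫ ω, g ω ^ 2 ∂P := by
  have hfg : Integrable (fun ω => 2 * x * (f ω * g ω)) P := (hf.integrable_mul hg).const_mul _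
  have hf2 : Integrable (fun ω => f ω ^ 2) P := hf.integrable_sq
  have hg2 : Integrable (fun ω => x ^ 2 * g ω ^ 2) P := hg.integrable_sq.const_mul _
  have h1 : Integrable (fun ω => f ω ^ 2 + 2 * x * (f ω * g ω)) P := hf2.add hfg
  rw [← integral_const_mul, ← integral_const_mul, ← integral_add hf2 hfg, ← integral_add h1 hg2]
  congr 1
  ext ω
  ring

/-- The quadratic polynomial `x ↦ ∫ (f + x g)²` is non-negative, so its discriminant is not
positive. -/
theorem abs_integral_mul_le_sqrt {f g : Ω → ℝ} (hf : MemLp f 2 P) (hg : MemLp g 2 P) :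
    |∫ ω, f ω * g ω ∂P| ≤ √(∫ ω, f ω ^ 2 ∂P) * √(∫ ω, g ω ^ 2 ∂P) := by
  have h : ∀ x : ℝ, 0 ≤ (∫ ω, g ω ^ 2 ∂P) * (x * x) + (2 * ∫ ω, f ω * g ω ∂P) * x
      + ∫ ω, f ω ^ 2 ∂P := by
    intro x
    have h1 : 0 ≤ ∫ ω, (f ω + x * g ω) ^ 2 ∂P := integral_nonneg fun ω => sq_nonneg _
    rw [integral_add_mul_sq hf hg] at h1
    linarith
  have hd := discrim_le_zero h
  have hd' : (∫ ω, f ω * g ω ∂P) ^ 2 ≤ (∫ ω, f ω ^ 2 ∂P) * ∫ ω, g ω ^ 2 ∂P := by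
    rw [discrim] at hd; nlinarith
  rw [← Real.sqrt_mul (integral_nonneg fun ω => sq_nonneg _)]
  exact Real.abs_le_sqrt hd'

/-- Minkowski's inequality for square-integrable functions. -/
theorem integral_add_mul_sq_le {f g : Ω → ℝ} (hf : MemLp f 2 P) (hg : MemLp g 2 P) (x : ℝ) :
    ∫ ω, (f ω + x * g ω) ^ 2 ∂P ≤
      (√(∫ ω, f ω ^ 2 ∂P) + |x| * √(∫ ω, g ω ^ 2 ∂P)) ^ 2 := by
  rw [integral_add_mul_sq hf hg, add_sq, mul_pow, sq_abs,
    Real.sq_sqrt (integral_nonneg fun ω => sq_nonneg _),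
    Real.sq_sqrt (integral_nonneg fun ω => sq_nonneg _)]
  have h1 : x * ∫ ω, f ω * g ω ∂P ≤ |x| * |∫ ω, f ω * g ω ∂P| := by
    rw [← abs_mul]; exact le_abs_self _
  have h2 := mul_le_mul_of_nonneg_left (abs_integral_mul_le_sqrt hf hg) (abs_nonneg x)
  linarith

theorem _root_.MeasureTheory.MeasurePreserving.integral_comp_of_aestronglyMeasurable
    {Ω' : Type*} [MeasurableSpace Ω'] {Q : Measure Ω'} {f : Ω → Ω'}
    (hf : MeasurePreserving f P Q) {g : Ω' → ℝ} (hg : AEStronglyMeasurable g Q) :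
    ∫ x, g (f x) ∂P = ∫ y, g y ∂Q := by
  rw [← hf.map_eq, integral_map hf.aemeasurable (hf.map_eq ▸ hg)]

end SquareIntegrable

/-! ### Splitting a trajectory at a fixed time. -/

section Concat

variable {G : Type*}

/-- The sequence that follows the first argument before time `n` and the second one from then on. -/
def concat (n : ℕ) (p : (ℕ → G) × (ℕ → G)) (i : ℕ) : G :=
  if i < n then p.1 i else p.2 (i - n)

theorem concat_of_lt {n i : ℕ} (h : i < n) (p : (ℕ → G) × (ℕ → G)) : concat n p i = p.1 i :=
  if_pos h

theorem concat_add (n i : ℕ) (p : (ℕ → G) × (ℕ → G)) : concat n p (n + i) = p.2 i := by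
  simp [concat]

theorem sum_concat {M : Type*} [AddCommMonoid M] (f : G → M) (n m : ℕ)
    (p : (ℕ → G) × (ℕ → G)) :
    ∑ j ∈ Finset.range (n + m), f (concat n p j) =
      ∑ j ∈ Finset.range n, f (p.1 j) + ∑ j ∈ Finset.range m, f (p.2 j) := by
  rw [Finset.sum_range_add]
  congr 1
  · exact Finset.sum_congr rfl fun j hj => by rw [concat_of_lt (Finset.mem_range.1 hj)]
  · simp only [concat_add]

theorem prod_concat {M : Type*} [CommMonoid M] (f : G → M) (n m : ℕ)
    (p : (ℕ → G) × (ℕ → G)) :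
    ∏ j ∈ Finset.range (n + m), f (concat n p j) =
      (∏ j ∈ Finset.range n, f (p.1 j)) * ∏ j ∈ Finset.range m, f (p.2 j) := by
  rw [Finset.prod_range_add]
  congr 1
  · exact Finset.prod_congr rfl fun j hj => by rw [concat_of_lt (Finset.mem_range.1 hj)]
  · simp only [concat_add]

theorem Z_congr [Group G] {n : ℕ} {ω ω' : ℕ → G} (h : ∀ i < n, ω i = ω' i) : Z n ω = Z n ω' := by
  induction n with
  | zero => rfl
  | succ n ih => simp only [Z]; rw [ih fun i hi => h i (by omega), h n (by omega)]

theorem Z_concat_self [Group G] (n : ℕ) (p : (ℕ → G) × (ℕ → G)) :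
    Z n (concat n p) = Z n p.1 :=
  Z_congr fun _ hi => concat_of_lt hi p

theorem Z_concat [Group G] (n m : ℕ) (p : (ℕ → G) × (ℕ → G)) :
    Z (n + m) (concat n p) = Z n p.1 * Z m p.2 := by
  induction m with
  | zero => simp [Z, Z_concat_self]
  | succ m ih => rw [← add_assoc]; simp only [Z]; rw [ih, concat_add, mul_assoc]

variable [MeasurableSpace G]

instance isProbabilityMeasure_pathMeasure (μ : PMF G) : IsProbabilityMeasure (pathMeasure μ) := by
  unfold pathMeasure; infer_instance

theorem measurable_concat (n : ℕ) : Measurable (concat (G := G) n) := by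
  refine measurable_pi_lambda _ fun i => ?_
  by_cases h : i < n
  · simp only [concat, h, if_true]; fun_prop
  · simp only [concat, h, if_false]; fun_prop

/-- This is the Markov property in the form used throughout: the increments before and after time
`n` are two independent walks. The preimage of a cylinder is a product of two cylinders, and the
finite products of masses agree. -/
theorem measurePreserving_concat (μ : PMF G) (n : ℕ) :
    MeasurePreserving (concat n) ((pathMeasure μ).prod (pathMeasure μ)) (pathMeasure μ) := by
  refine ⟨measurable_concat n, Measure.eq_infinitePi _ fun s t ht => ?_⟩
  have hpre : concat n ⁻¹' (Set.pi s t) =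
      (Set.pi (s.filter (· < n) : Finset ℕ) t) ×ˢ
        (Set.pi ((s.filter (¬ · < n)).image (· - n) : Finset ℕ) fun i => t (n + i)) := by
    ext p
    simp only [Set.mem_preimage, Set.mem_pi, Set.mem_prod, Finset.mem_coe, Finset.mem_filter,
      Finset.mem_image]
    constructor
    · refine fun h => ⟨fun i hi => concat_of_lt hi.2 p ▸ h i hi.1, ?_⟩
      rintro _ ⟨i, ⟨hi, hn⟩, rfl⟩
      have := h i hi
      rw [show n + (i - n) = i by omega]
      simpa [concat, hn] using this
    · rintro ⟨h1, h2⟩ i hi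
      by_cases hn : i < n
      · rw [concat_of_lt hn]; exact h1 i ⟨hi, hn⟩
      · have := h2 (i - n) ⟨i, ⟨hi, hn⟩, rfl⟩
        rw [show n + (i - n) = i by omega] at this
        simpa [concat, hn] using this
  rw [Measure.map_apply (measurable_concat n)
    (MeasurableSet.pi s.countable_toSet fun i _ => ht i), hpre, Measure.prod_prod, pathMeasure,
    Measure.infinitePi_pi _ fun i _ => ht i, Measure.infinitePi_pi _ fun i _ => ht (n + i),
    Finset.prod_image (by intro a ha b hb; simp at ha hb ⊢; omega),
    ← Finset.prod_filter_mul_prod_filter_not s (· < n)]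
  congr 1
  refine Finset.prod_congr rfl fun i hi => ?_
  rw [Finset.mem_filter] at hi
  rw [show n + (i - n) = i by omega]

theorem measurePreserving_eval (μ : PMF G) (i : ℕ) :
    MeasurePreserving (fun ω : ℕ → G => ω i) (pathMeasure μ) μ.toMeasure :=
  measurePreserving_eval_infinitePi _ i

end Concat

/-! ### The Gromov product as the defect of additivity. -/

section PathProd

variable {G : Type*} [Group G] [MetricSpace G]

/-- The Gromov product of the endpoint of a trajectory and the identity, seen from the position at
an intermediate time. -/
noncomputable def pathProd (n m : ℕ) (ω : ℕ → G) : ℝ := gromovProd (1 : G) (Z (n + m) ω) (Z n ω)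

theorem pathProd_nonneg (n m : ℕ) (ω : ℕ → G) : 0 ≤ pathProd n m ω := by
  have := dist_triangle (1 : G) (Z n ω) (Z (n + m) ω)
  rw [dist_comm 1 (Z n ω)] at this
  unfold pathProd gromovProd
  linarith

/-- This bound makes the Gromov product square integrable as soon as the distance is. -/
theorem pathProd_le (n m : ℕ) (ω : ℕ → G) : pathProd n m ω ≤ dist 1 (Z n ω) := by
  have := dist_triangle (Z n ω) 1 (Z (n + m) ω)
  rw [dist_comm (Z n ω) 1] at this
  unfold pathProd gromovProd
  rw [dist_comm (Z n ω) 1]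
  linarith

theorem integral_pathProd_nonneg [MeasurableSpace G] (μ : PMF G) (n m : ℕ) :
    0 ≤ ∫ ω, pathProd n m ω ∂(pathMeasure μ) :=
  integral_nonneg fun ω => pathProd_nonneg n m ω

theorem dist_Z_concat [IsIsometricSMul G G] (n m : ℕ) (p : (ℕ → G) × (ℕ → G)) :
    dist 1 (Z (n + m) (concat n p)) =
      dist 1 (Z n p.1) + dist 1 (Z m p.2) - 2 * pathProd n m (concat n p) := by
  have h : dist (Z n p.1) (Z n p.1 * Z m p.2) = dist 1 (Z m p.2) := by
    nth_rewrite 1 [← mul_one (Z n p.1)]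
    rw [dist_mul_left]
  unfold pathProd gromovProd
  rw [Z_concat_self, Z_concat, h, dist_comm (Z n p.1) 1]
  ring

end PathProd

section Measurability

variable {G : Type*} [Countable G] [MeasurableSpace G] [DiscreteMeasurableSpace G]

theorem measurable_Z [Group G] (n : ℕ) : Measurable (Z n : (ℕ → G) → G) := by
  induction n with
  | zero => exact measurable_const
  | succ n ih =>
    have h : Measurable fun p : G × G => p.1 * p.2 := Measurable.of_discrete
    exact h.comp (ih.prodMk (measurable_pi_apply n))

theorem lintegral_pmf (μ : PMF G) (f : G → ℝ≥0∞) :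
    ∫⁻ x, f x ∂μ.toMeasure = ∑' x, f x * μ x := by
  rw [lintegral_countable']
  exact tsum_congr fun x => by rw [PMF.toMeasure_apply_singleton _ _ (measurableSet_singleton x)]

end Measurability

/-! ### Mean distance and rate of escape. -/

section Distance

variable {G : Type*} [Group G] [Countable G] [MetricSpace G]
  [MeasurableSpace G] [DiscreteMeasurableSpace G]

theorem measurable_dist_Z (n : ℕ) : Measurable fun ω : ℕ → G => dist (1 : G) (Z n ω) :=
  (Measurable.of_discrete (f := fun x : G => dist 1 x)).comp (measurable_Z n)

/-- The mean distance to the identity at time `n`. -/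
noncomputable def meanDist (μ : PMF G) (n : ℕ) : ℝ :=
  ∫ ω, dist (1 : G) (Z n ω) ∂(pathMeasure μ)

theorem memLp_dist_one {μ : PMF G} (hμ : HasFiniteMoment 2 μ) :
    MemLp (fun x : G => dist 1 x) 2 μ.toMeasure := by
  rw [memLp_two_iff_integrable_sq Measurable.of_discrete.aestronglyMeasurable]
  refine ⟨Measurable.of_discrete.aestronglyMeasurable, ?_⟩
  rw [HasFiniteIntegral, lintegral_pmf]
  have h : ∀ x : G, ‖dist 1 x ^ 2‖ₑ * μ x =
      ENNReal.ofReal (dist 1 x ^ (2 : ℝ) * (μ x).toReal) := by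
    intro x
    rw [ENNReal.ofReal_mul (by positivity), ENNReal.ofReal_toReal (μ.apply_ne_top x),
      Real.rpow_two, Real.enorm_of_nonneg (sq_nonneg _)]
  simp_rw [h]
  exact hμ.tsum_ofReal_lt_top

theorem measurable_pathProd (n m : ℕ) : Measurable (pathProd (G := G) n m) := by
  have h : Measurable fun p : G × G => gromovProd 1 p.1 p.2 := Measurable.of_discrete
  exact h.comp ((measurable_Z (n + m)).prodMk (measurable_Z n))

theorem integral_pathProd_rpow_le {μ : PMF G} {p : ℝ} {τ : ℝ≥0} (h : DeviationWith p τ μ)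
    (n m : ℕ) : ∫ ω, pathProd n m ω ^ p ∂(pathMeasure μ) ≤ τ := by
  rw [integral_eq_lintegral_of_nonneg_ae
    (ae_of_all _ fun ω => Real.rpow_nonneg (pathProd_nonneg n m ω) p)
    ((measurable_pathProd n m).pow_const p).aestronglyMeasurable]
  exact ENNReal.toReal_le_of_le_ofReal τ.2 (by simpa [pathProd] using h n m)

theorem integral_pathProd_le {μ : PMF G} {τ : ℝ≥0} (h : DeviationWith 1 τ μ)
    (n m : ℕ) : ∫ ω, pathProd n m ω ∂(pathMeasure μ) ≤ τ := by
  simpa using integral_pathProd_rpow_le h n m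

theorem integral_pathProd_sq_le {μ : PMF G} {τ : ℝ≥0} (h : DeviationWith 2 τ μ)
    (n m : ℕ) : ∫ ω, pathProd n m ω ^ 2 ∂(pathMeasure μ) ≤ τ := by
  simpa using integral_pathProd_rpow_le h n m

variable [IsIsometricSMul G G]

theorem memLp_dist_Z {μ : PMF G} (hμ : HasFiniteMoment 2 μ) (n : ℕ) :
    MemLp (fun ω : ℕ → G => dist (1 : G) (Z n ω)) 2 (pathMeasure μ) := by
  induction n with
  | zero => simp [Z]
  | succ n ih =>
    have h := (memLp_dist_one hμ).comp_measurePreserving (measurePreserving_eval μ n)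
    refine (ih.add h).mono (measurable_dist_Z _).aestronglyMeasurable (ae_of_all _ fun ω => ?_)
    simp only [Pi.add_apply, Function.comp, Real.norm_eq_abs, Z]
    rw [abs_of_nonneg dist_nonneg, abs_of_nonneg (add_nonneg dist_nonneg dist_nonneg)]
    refine (dist_triangle _ (Z n ω) _).trans_eq ?_
    nth_rewrite 2 [← mul_one (Z n ω)]
    rw [dist_mul_left]

theorem integrable_dist_Z {μ : PMF G} (hμ : HasFiniteMoment 2 μ) (n : ℕ) :
    Integrable (fun ω : ℕ → G => dist (1 : G) (Z n ω)) (pathMeasure μ) :=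
  (memLp_dist_Z hμ n).integrable one_le_two

theorem memLp_pathProd {μ : PMF G} (hμ : HasFiniteMoment 2 μ) (n m : ℕ) :
    MemLp (pathProd (G := G) n m) 2 (pathMeasure μ) := by
  refine (memLp_dist_Z hμ n).mono (measurable_pathProd n m).aestronglyMeasurable
    (ae_of_all _ fun ω => ?_)
  rw [Real.norm_of_nonneg (pathProd_nonneg n m ω), Real.norm_of_nonneg dist_nonneg]
  exact pathProd_le n m ω

theorem meanDist_add {μ : PMF G} (hμ : HasFiniteMoment 2 μ) (n m : ℕ) :
    meanDist μ (n + m) =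
      meanDist μ n + meanDist μ m - 2 * ∫ ω, pathProd n m ω ∂(pathMeasure μ) := by
  have hc := measurePreserving_concat μ n
  have i1 : Integrable (fun p : (ℕ → G) × (ℕ → G) => dist 1 (Z n p.1))
      ((pathMeasure μ).prod (pathMeasure μ)) := (integrable_dist_Z hμ n).comp_fst _
  have i2 : Integrable (fun p : (ℕ → G) × (ℕ → G) => dist 1 (Z m p.2))
      ((pathMeasure μ).prod (pathMeasure μ)) := (integrable_dist_Z hμ m).comp_snd _
  have i3 : Integrable (fun p : (ℕ → G) × (ℕ → G) => 2 * pathProd n m (concat n p))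
      ((pathMeasure μ).prod (pathMeasure μ)) :=
    (hc.integrable_comp_of_integrable
      ((memLp_pathProd hμ n m).integrable one_le_two)).const_mul 2
  have i4 : Integrable (fun p : (ℕ → G) × (ℕ → G) => dist 1 (Z n p.1) + dist 1 (Z m p.2))
      ((pathMeasure μ).prod (pathMeasure μ)) := i1.add i2
  unfold meanDist
  rw [← hc.integral_comp_of_aestronglyMeasurable (measurable_dist_Z _).aestronglyMeasurable]
  simp_rw [dist_Z_concat]
  rw [integral_sub i4 i3, integral_add i1 i2, integral_const_mul,
    hc.integral_comp_of_aestronglyMeasurable (measurable_pathProd n m).aestronglyMeasurable,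
    integral_fun_fst (fun ω : ℕ → G => dist 1 (Z n ω)),
    integral_fun_snd (fun ω : ℕ → G => dist 1 (Z m ω))]
  simp

theorem subadditive_meanDist {μ : PMF G} (hμ : HasFiniteMoment 2 μ) :
    Subadditive (meanDist μ) := by
  intro n m
  rw [meanDist_add hμ]
  have := integral_pathProd_nonneg μ n m
  linarith

theorem tendsto_meanDist_div {μ : PMF G} (hμ : HasFiniteMoment 2 μ) :
    Tendsto (fun n : ℕ => 1 / (n : ℝ) * meanDist μ n) atTop (𝓝 (rateOfEscape μ)) := by
  have hb : BddBelow (Set.range fun n : ℕ => meanDist μ n / n) :=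
    ⟨0, by rintro _ ⟨n, rfl⟩; exact div_nonneg (integral_nonneg fun _ => dist_nonneg) n.cast_nonneg⟩
  have h := (subadditive_meanDist hμ).tendsto_lim hb
  have h' : Tendsto (fun n : ℕ => 1 / (n : ℝ) * meanDist μ n) atTop
      (𝓝 (subadditive_meanDist hμ).lim) := by
    refine h.congr fun n => ?_
    rw [one_div_mul_eq_div]
  exact tendsto_nhds_limUnder ⟨_, h'⟩

/-- Adding `k` blocks of length `n` costs at most `2τ` per block; divide by `k` and let `k → ∞`. The
bound depends on the measure only through `τ`, which is where local uniformity enters. -/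
theorem abs_meanDist_sub_le {μ : PMF G} (hμ : HasFiniteMoment 2 μ) {τ : ℝ≥0}
    (h : DeviationWith 1 τ μ) {n : ℕ} (hn : n ≠ 0) :
    |meanDist μ n - n * rateOfEscape μ| ≤ 2 * τ := by
  have hlim := tendsto_meanDist_div hμ
  have hmul : Tendsto (fun k : ℕ => k * n) atTop atTop :=
    tendsto_id.atTop_mul_const' (Nat.pos_of_ne_zero hn)
  have hlim' := (hlim.comp hmul).const_mul (n : ℝ)
  have key : ∀ k : ℕ, |meanDist μ (k * n) - k * meanDist μ n| ≤ 2 * τ * k := by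
    intro k
    induction k with
    | zero => simp [meanDist, Z]
    | succ k ih =>
      have h1 := integral_pathProd_le h (k * n) n
      have h2 := integral_pathProd_nonneg μ (k * n) n
      rw [add_mul, one_mul, meanDist_add hμ, abs_le]
      rw [abs_le] at ih
      push_cast
      have := τ.2
      constructor <;> linarith
  have hlim3 : Tendsto (fun k : ℕ => |meanDist μ n -
      n * (1 / ((k * n : ℕ) : ℝ) * meanDist μ (k * n))|) atTop
      (𝓝 |meanDist μ n - n * rateOfEscape μ|) := (hlim'.const_sub (meanDist μ n)).abs
  refine le_of_tendsto hlim3 ?_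
  filter_upwards [eventually_gt_atTop 0] with k hk
  have hk' : (0 : ℝ) < k := by exact_mod_cast hk
  have hn' : (n : ℝ) ≠ 0 := by exact_mod_cast hn
  have e : meanDist μ n - n * (1 / ((k * n : ℕ) : ℝ) * meanDist μ (k * n)) =
      -((meanDist μ (k * n) - k * meanDist μ n) / k) := by
    push_cast; field_simp; ring
  rw [e, abs_neg, abs_div, abs_of_pos hk', div_le_iff₀ hk']
  exact key k

end Distance

/-! ### Almost subadditive and almost additive sequences. -/

section RealSequences

/-- Doubling the index multiplies `s` by at most `√2`, up to a constant, so halving the index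
repeatedly gives growth of order `√n`. -/
theorem exists_le_mul_sqrt {s : ℕ → ℝ} {c : ℝ} (hc : 0 ≤ c) (hs : ∀ n, 0 ≤ s n) (h0 : s 0 = 0)
    (h : ∀ n m, s (n + m) ≤ √(s n ^ 2 + s m ^ 2) + c) : ∃ A : ℝ, ∀ n : ℕ, s n ≤ A * √n := by
  set c' := 2 * c + s 1 with hc'
  have hc'0 : 0 ≤ c' := by have := hs 1; positivity
  have h2 : (5 / 4 : ℝ) ≤ √2 := Real.le_sqrt_of_sq_le (by norm_num)
  have heven : ∀ n, s (2 * n) ≤ √2 * s n + c := by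
    intro n
    have := h n n
    rwa [← two_mul, ← two_mul, Real.sqrt_mul (by norm_num), Real.sqrt_sq (hs n)] at this
  have hodd : ∀ n, s (2 * n + 1) ≤ √2 * s n + c' := by
    intro n
    have h3 : √(s (2 * n) ^ 2 + s 1 ^ 2) ≤ s (2 * n) + s 1 := by
      rw [Real.sqrt_le_left (add_nonneg (hs _) (hs _))]
      nlinarith [hs (2 * n), hs 1, mul_nonneg (hs (2 * n)) (hs 1)]
    linarith [h (2 * n) 1, heven n]
  -- The subtracted `4 * c'` makes the induction close: since `√2 ≥ 5/4`, one has `-√2 * 4c' + c' ≤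
  -- -4c'`. There is equality at `n = 1`.
  have key : ∀ n : ℕ, n ≠ 0 → s n ≤ (s 1 + 4 * c') * √n - 4 * c' := by
    intro n
    induction n using Nat.strong_induction_on with
    | _ n ih =>
      intro hn
      obtain rfl | hn1 := eq_or_ne n 1
      · simp
      have hA : 0 ≤ s 1 + 4 * c' := by have := hs 1; positivity
      have hhalf := ih (n / 2) (by omega) (by omega)
      have hstep : s n ≤ √2 * s (n / 2) + c' := by
        rcases Nat.even_or_odd' n with ⟨k, rfl | rfl⟩
        · rw [show 2 * k / 2 = k by omega]
          linarith [heven k, hs 1]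
        · rw [show (2 * k + 1) / 2 = k by omega]
          exact hodd k
      have hsq : √2 * √((n / 2 : ℕ) : ℝ) ≤ √n := by
        rw [← Real.sqrt_mul (by norm_num)]
        refine Real.sqrt_le_sqrt ?_
        have : 2 * (n / 2) ≤ n := by omega
        exact_mod_cast this
      have h4 := mul_le_mul_of_nonneg_left hhalf (Real.sqrt_nonneg 2)
      have h5 := mul_le_mul_of_nonneg_left hsq hA
      nlinarith
  refine ⟨s 1 + 4 * c', fun n => ?_⟩
  obtain rfl | hn := eq_or_ne n 0
  · simp [h0]
  · linarith [key n hn]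

/-- A sequence that is additive up to an error of the order of the square root grows linearly. -/
theorem exists_tendsto_div_of_almost_additive {c : ℕ → ℝ} {K : ℝ}
    (h : ∀ n m : ℕ, |c (n + m) - c n - c m| ≤ K * √((n + m : ℕ) : ℝ)) :
    ∃ σ : ℝ, Tendsto (fun n : ℕ => 1 / (n : ℝ) * c n) atTop (𝓝 σ) := by
  set r : ℝ := 1 / √2 with hr
  have hr0 : 0 ≤ r := by positivity
  have hr1 : r < 1 := by
    rw [hr, div_lt_one (by positivity)]
    exact Real.lt_sqrt_of_sq_lt (by norm_num)
  have hscale : ∀ (j n : ℕ), √((2 ^ j * n : ℕ) : ℝ) / 2 ^ j = √n * r ^ j := by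
    intro j n
    have h2 : (2 : ℝ) ^ j = √2 ^ j * √2 ^ j := by
      rw [← mul_pow, Real.mul_self_sqrt (by norm_num)]
    have h3 : √((2 : ℝ) ^ j) = √2 ^ j := by
      rw [Real.sqrt_eq_iff_mul_self_eq (by positivity) (by positivity), h2]
    push_cast
    rw [Real.sqrt_mul (by positivity), h3, h2, hr, div_pow, one_pow]
    field_simp
  -- Dyadic averaging: the defect at scale `2 ^ j` is `O(√(2 ^ j))`, so after division by `2 ^ j` it
  -- decays like `r ^ j`. The limit `L` in `j` is exactly additive, hence linear, and stays within
  -- `O(√n)` of `c`.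
  set a : ℕ → ℕ → ℝ := fun n j => c (2 ^ j * n) / 2 ^ j with ha
  have hadd : ∀ n m j : ℕ, |a (n + m) j - a n j - a m j| ≤ K * √((n + m : ℕ) : ℝ) * r ^ j := by
    intro n m j
    have h1 := h (2 ^ j * n) (2 ^ j * m)
    rw [← mul_add] at h1
    have e : a (n + m) j - a n j - a m j =
        (c (2 ^ j * (n + m)) - c (2 ^ j * n) - c (2 ^ j * m)) / 2 ^ j := by
      simp only [ha]; ring
    rw [e, abs_div, abs_of_pos (by positivity : (0 : ℝ) < 2 ^ j), mul_assoc, ← hscale,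
      ← mul_div_assoc]
    gcongr
  have hstep : ∀ n j : ℕ, dist (a n j) (a n (j + 1)) ≤ K * √(2 * n : ℕ) / 2 * r ^ j := by
    intro n j
    have h1 := hadd n n j
    have e : a n j - a n (j + 1) = -((a (n + n) j - a n j - a n j) / 2) := by
      simp only [ha]
      rw [show 2 ^ (j + 1) * n = 2 ^ j * (n + n) by ring]
      field_simp
      ring
    rw [Real.dist_eq, e, abs_neg, abs_div, abs_two, two_mul n]
    linarith
  choose L hL using fun n => cauchySeq_tendsto_of_complete
    (cauchySeq_of_le_geometric r _ hr1 (hstep n))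
  have hLdist : ∀ n, |c n - L n| ≤ K * √(2 * n : ℕ) / 2 / (1 - r) := by
    intro n
    have := dist_le_of_le_geometric_of_tendsto₀ r _ hr1 (hstep n) (hL n)
    simpa [ha, Real.dist_eq] using this
  have hLadd : ∀ n m, L (n + m) = L n + L m := by
    intro n m
    have h1 := ((hL (n + m)).sub (hL n)).sub (hL m)
    have h2 : Tendsto (fun j => a (n + m) j - a n j - a m j) atTop (𝓝 0) := by
      refine squeeze_zero_norm (hadd n m) ?_
      simpa using (tendsto_pow_atTop_nhds_zero_of_lt_one hr0 hr1).const_mul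
        (K * √((n + m : ℕ) : ℝ))
    have := tendsto_nhds_unique h1 h2
    linarith
  have hLmul : ∀ n : ℕ, L n = n * L 1 := by
    intro n
    induction n with
    | zero => have := hLadd 0 0; simp at this; simpa using this
    | succ n ih => rw [hLadd, ih]; push_cast; ring
  refine ⟨L 1, ?_⟩
  rw [tendsto_iff_norm_sub_tendsto_zero]
  have hlim : Tendsto (fun n : ℕ => K * √2 / 2 / (1 - r) * (√(n : ℝ))⁻¹) atTop (𝓝 0) := by
    have := (Real.tendsto_sqrt_atTop.comp tendsto_natCast_atTop_atTop).inv_tendsto_atTop.const_mul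
      (K * √2 / 2 / (1 - r))
    simpa using this
  refine squeeze_zero' (Eventually.of_forall fun n => norm_nonneg _) ?_ hlim
  filter_upwards [eventually_gt_atTop 0] with n hn
  have hn' : (0 : ℝ) < n := by exact_mod_cast hn
  have h1 := hLdist n
  have hs : √(n : ℝ) * √n = n := Real.mul_self_sqrt hn'.le
  have hs0 : 0 < √(n : ℝ) := Real.sqrt_pos.2 hn'
  rw [hLmul] at h1
  have e : 1 / (n : ℝ) * c n - L 1 = (c n - n * L 1) / n := by field_simp
  rw [Real.norm_eq_abs, e, abs_div, abs_of_pos hn', div_le_iff₀ hn']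
  refine h1.trans_eq ?_
  push_cast
  rw [Real.sqrt_mul (by norm_num)]
  have hinv : (√(n : ℝ))⁻¹ * n = √n := by rw [inv_mul_eq_iff_eq_mul₀ hs0.ne', hs]
  rw [mul_assoc (K * √2 / 2 / (1 - r)), hinv]
  ring

end RealSequences

/-! ### Products of sums over independent halves. -/

section Increments

variable {Ω Ω' : Type*} [MeasurableSpace Ω] [MeasurableSpace Ω']

theorem integral_prod_add_mul_add {P : Measure Ω} {Q : Measure Ω'} [IsProbabilityMeasure P]
    [IsProbabilityMeasure Q] {X X' : Ω → ℝ} {Y Y' : Ω' → ℝ} (hX : MemLp X 2 P)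
    (hX' : MemLp X' 2 P) (hY : MemLp Y 2 Q) (hY' : MemLp Y' 2 Q) :
    ∫ p, (X p.1 + Y p.2) * (X' p.1 + Y' p.2) ∂(P.prod Q) =
      ∫ ω, X ω * X' ω ∂P + (∫ ω, X ω ∂P) * (∫ ω, Y' ω ∂Q) + (∫ ω, X' ω ∂P) * (∫ ω, Y ω ∂Q)
        + ∫ ω, Y ω * Y' ω ∂Q := by
  have i1 : Integrable (fun p : Ω × Ω' => X p.1 * X' p.1) (P.prod Q) :=
    (hX.integrable_mul hX').comp_fst Q
  have i2 : Integrable (fun p : Ω × Ω' => X p.1 * Y' p.2) (P.prod Q) :=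
    (hX.integrable one_le_two).mul_prod (hY'.integrable one_le_two)
  have i3 : Integrable (fun p : Ω × Ω' => X' p.1 * Y p.2) (P.prod Q) :=
    (hX'.integrable one_le_two).mul_prod (hY.integrable one_le_two)
  have i4 : Integrable (fun p : Ω × Ω' => Y p.2 * Y' p.2) (P.prod Q) :=
    (hY.integrable_mul hY').comp_snd P
  have i12 : Integrable (fun p : Ω × Ω' => X p.1 * X' p.1 + X p.1 * Y' p.2) (P.prod Q) :=
    i1.add i2
  have i123 : Integrable (fun p : Ω × Ω' => X p.1 * X' p.1 + X p.1 * Y' p.2 + X' p.1 * Y p.2)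
      (P.prod Q) := i12.add i3
  have e : (fun p : Ω × Ω' => (X p.1 + Y p.2) * (X' p.1 + Y' p.2)) =
      fun p => X p.1 * X' p.1 + X p.1 * Y' p.2 + X' p.1 * Y p.2 + Y p.2 * Y' p.2 := by
    ext p; ring
  rw [e, integral_add i123 i4, integral_add i12 i3, integral_add i1 i2, integral_prod_mul,
    integral_prod_mul, integral_fun_fst (fun ω => X ω * X' ω),
    integral_fun_snd (fun ω => Y ω * Y' ω)]
  simp

theorem integral_sub_integral_sq_le {P : Measure Ω} [IsProbabilityMeasure P] {X : Ω → ℝ}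
    (hX : MemLp X 2 P) : ∫ ω, (X ω - ∫ ω', X ω' ∂P) ^ 2 ∂P ≤ ∫ ω, X ω ^ 2 ∂P := by
  rw [← ProbabilityTheory.variance_eq_integral hX.aemeasurable]
  exact ProbabilityTheory.variance_le_expectation_sq hX.aestronglyMeasurable

end Increments

/-! ### Sums and products over independent increments. -/

section Increments

variable {G : Type*}

/-- The sum of the values of `f` at the first `n` increments. -/
def incSum (f : G → ℝ) (n : ℕ) (ω : ℕ → G) : ℝ := ∑ j ∈ Finset.range n, f (ω j)

/-- The product of the values of `f` at the first `n` increments. -/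
def incProd (f : G → ℝ) (n : ℕ) (ω : ℕ → G) : ℝ := ∏ j ∈ Finset.range n, f (ω j)

theorem abs_incSum_le {f : G → ℝ} {C : ℝ} (hf : ∀ a, |f a| ≤ C) (n : ℕ) (ω : ℕ → G) :
    |incSum f n ω| ≤ n * C := by
  refine (Finset.abs_sum_le_sum_abs _ _).trans ?_
  refine (Finset.sum_le_sum fun j _ => hf (ω j)).trans_eq ?_
  simp

theorem abs_incProd_le {f : G → ℝ} {C : ℝ} (hf : ∀ a, |f a| ≤ C) (n : ℕ) (ω : ℕ → G) :
    |incProd f n ω| ≤ C ^ n := by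
  rw [incProd, Finset.abs_prod]
  refine (Finset.prod_le_prod (fun j _ => abs_nonneg _) fun j _ => hf (ω j)).trans_eq ?_
  simp

theorem incSum_concat (f : G → ℝ) (n m : ℕ) (p : (ℕ → G) × (ℕ → G)) :
    incSum f (n + m) (concat n p) = incSum f n p.1 + incSum f m p.2 :=
  sum_concat f n m p

theorem incProd_concat_one (f : G → ℝ) (n : ℕ) (p : (ℕ → G) × (ℕ → G)) :
    incProd f (n + 1) (concat n p) = incProd f n p.1 * f (p.2 0) := by
  simp [incProd, prod_concat]

variable [MeasurableSpace G] [DiscreteMeasurableSpace G]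

theorem memLp_of_bounded {f : G → ℝ} {C : ℝ} (hf : ∀ a, |f a| ≤ C) (p : ℝ≥0∞) (μ : PMF G) :
    MemLp f p μ.toMeasure :=
  MemLp.of_bound Measurable.of_discrete.aestronglyMeasurable C (ae_of_all _ hf)

theorem measurable_incSum (f : G → ℝ) (n : ℕ) : Measurable (incSum f n) :=
  Finset.measurable_sum _ fun j _ =>
    (Measurable.of_discrete (f := f)).comp (measurable_pi_apply j)

theorem measurable_incProd (f : G → ℝ) (n : ℕ) : Measurable (incProd f n) :=
  Finset.measurable_prod _ fun j _ =>
    (Measurable.of_discrete (f := f)).comp (measurable_pi_apply j)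

variable {μ : PMF G} {f : G → ℝ} {C : ℝ}

theorem memLp_incSum (hf : ∀ a, |f a| ≤ C) (p : ℝ≥0∞) (n : ℕ) :
    MemLp (incSum f n) p (pathMeasure μ) :=
  MemLp.of_bound (measurable_incSum f n).aestronglyMeasurable _ (ae_of_all _ (abs_incSum_le hf n))

theorem memLp_incProd (hf : ∀ a, |f a| ≤ C) (p : ℝ≥0∞) (n : ℕ) :
    MemLp (incProd f n) p (pathMeasure μ) :=
  MemLp.of_bound (measurable_incProd f n).aestronglyMeasurable _
    (ae_of_all _ (abs_incProd_le hf n))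

theorem integral_comp_eval (μ : PMF G) (f : G → ℝ) (i : ℕ) :
    ∫ ω, f (ω i) ∂(pathMeasure μ) = ∫ x, f x ∂μ.toMeasure :=
  (measurePreserving_eval μ i).integral_comp_of_aestronglyMeasurable
    Measurable.of_discrete.aestronglyMeasurable

theorem memLp_comp_eval (hf : ∀ a, |f a| ≤ C) (p : ℝ≥0∞) (i : ℕ) :
    MemLp (fun ω : ℕ → G => f (ω i)) p (pathMeasure μ) :=
  (memLp_of_bounded hf p μ).comp_measurePreserving (measurePreserving_eval μ i)

theorem integral_incSum (hf : ∀ a, |f a| ≤ C) (n : ℕ) :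
    ∫ ω, incSum f n ω ∂(pathMeasure μ) = n * ∫ x, f x ∂μ.toMeasure := by
  simp only [incSum]
  rw [integral_finsetSum _ fun i _ => (memLp_comp_eval hf 1 i).integrable le_rfl]
  simp [integral_comp_eval]

theorem integral_incSum_sq (hf : ∀ a, |f a| ≤ C) (hf0 : ∫ x, f x ∂μ.toMeasure = 0) (n : ℕ) :
    ∫ ω, incSum f n ω ^ 2 ∂(pathMeasure μ) = n * ∫ x, f x ^ 2 ∂μ.toMeasure := by
  induction n with
  | zero => simp [incSum]
  | succ n ih =>
    rw [← (measurePreserving_concat μ n).integral_comp_of_aestronglyMeasurable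
      ((measurable_incSum f _).pow_const 2).aestronglyMeasurable]
    simp_rw [incSum_concat, sq]
    rw [integral_prod_add_mul_add (memLp_incSum hf 2 n) (memLp_incSum hf 2 n)
      (memLp_incSum hf 2 1) (memLp_incSum hf 2 1), integral_incSum hf 1, hf0]
    simp_rw [← sq]
    rw [ih]
    simp only [incSum, Finset.sum_range_one]
    rw [integral_comp_eval μ (fun x => f x ^ 2) 0]
    push_cast
    ring

theorem integral_incProd (μ : PMF G) (f : G → ℝ) (n : ℕ) :
    ∫ ω, incProd f n ω ∂(pathMeasure μ) = (∫ x, f x ∂μ.toMeasure) ^ n := by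
  induction n with
  | zero => simp [incProd]
  | succ n ih =>
    rw [← (measurePreserving_concat μ n).integral_comp_of_aestronglyMeasurable
      (measurable_incProd f _).aestronglyMeasurable]
    simp_rw [incProd_concat_one]
    rw [integral_prod_mul (incProd f n) (fun ω : ℕ → G => f (ω 0)), ih, integral_comp_eval, pow_succ]

theorem integral_incProd_sq (μ : PMF G) (f : G → ℝ) (n : ℕ) :
    ∫ ω, incProd f n ω ^ 2 ∂(pathMeasure μ) = (∫ x, f x ^ 2 ∂μ.toMeasure) ^ n := by
  rw [← integral_incProd]
  simp only [incProd, Finset.prod_pow]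

/-- The product of `1 + f`, for a centred `f`, is approximated by its linear part. -/
theorem integral_incProd_sub_sq (hf : ∀ a, |f a| ≤ C) (hf0 : ∫ x, f x ∂μ.toMeasure = 0) (n : ℕ) :
    ∫ ω, (incProd (fun x => 1 + f x) n ω - 1 - incSum f n ω) ^ 2 ∂(pathMeasure μ) =
      (1 + ∫ x, f x ^ 2 ∂μ.toMeasure) ^ n - 1 - n * ∫ x, f x ^ 2 ∂μ.toMeasure := by
  set q := ∫ x, f x ^ 2 ∂μ.toMeasure with hq
  have hr : ∀ a, |1 + f a| ≤ 1 + C := fun a =>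
    (abs_add_le _ _).trans (by rw [abs_one]; exact add_le_add_right (hf a) 1)
  have fi : Integrable f μ.toMeasure := (memLp_of_bounded hf 1 μ).integrable le_rfl
  have fi2 : Integrable (fun x => f x ^ 2) μ.toMeasure := (memLp_of_bounded hf 2 μ).integrable_sq
  have hr1 : ∫ x, (1 + f x) ∂μ.toMeasure = 1 := by
    rw [integral_add (integrable_const 1) fi, hf0]; simp
  have hr2 : ∫ x, (1 + f x) ^ 2 ∂μ.toMeasure = 1 + q := by
    have := integral_add_mul_sq (memLp_const (1 : ℝ) (p := 2) (μ := μ.toMeasure))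
      (memLp_of_bounded hf 2 μ) 1
    simpa [hf0] using this
  have hrf : ∫ x, (1 + f x) * f x ∂μ.toMeasure = q := by
    simp_rw [add_mul, one_mul, ← sq]
    rw [integral_add fi fi2, hf0, zero_add]
  -- Induction on the last increment: the factor `1 + f` has mean `1` and keeps the old term, while
  -- `(1 + f) f` has mean `q` and contributes the new one.
  have hWS : ∀ n, ∫ ω, incProd (fun x => 1 + f x) n ω * incSum f n ω ∂(pathMeasure μ) = n * q := by
    intro n
    induction n with
    | zero => simp [incSum]
    | succ n ih =>
      have i1 : Integrable (fun p : (ℕ → G) × (ℕ → G) => incProd (fun x => 1 + f x) n p.1 *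
          incSum f n p.1 * (1 + f (p.2 0))) ((pathMeasure μ).prod (pathMeasure μ)) :=
        ((memLp_incProd hr 2 n).integrable_mul (memLp_incSum hf 2 n)).mul_prod
          ((memLp_comp_eval hr 1 0).integrable le_rfl)
      have i2 : Integrable (fun p : (ℕ → G) × (ℕ → G) => incProd (fun x => 1 + f x) n p.1 *
          ((1 + f (p.2 0)) * f (p.2 0))) ((pathMeasure μ).prod (pathMeasure μ)) :=
        ((memLp_incProd hr 1 n).integrable le_rfl).mul_prod
          ((memLp_comp_eval hr 2 0).integrable_mul (memLp_comp_eval hf 2 0))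
      rw [← (measurePreserving_concat μ n).integral_comp_of_aestronglyMeasurable
        (g := fun ω => incProd (fun x => 1 + f x) (n + 1) ω * incSum f (n + 1) ω)
        ((measurable_incProd _ _).mul (measurable_incSum f _)).aestronglyMeasurable]
      have e : ∀ p : (ℕ → G) × (ℕ → G), incProd (fun x => 1 + f x) (n + 1) (concat n p) *
          incSum f (n + 1) (concat n p) =
          incProd (fun x => 1 + f x) n p.1 * incSum f n p.1 * (1 + f (p.2 0)) +
          incProd (fun x => 1 + f x) n p.1 * ((1 + f (p.2 0)) * f (p.2 0)) := by
        intro p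
        rw [incProd_concat_one, incSum_concat]
        simp only [incSum, Finset.sum_range_one]
        ring
      simp_rw [e]
      rw [integral_add i1 i2,
        integral_prod_mul (fun ω => incProd (fun x => 1 + f x) n ω * incSum f n ω)
          (fun ω : ℕ → G => 1 + f (ω 0)),
        integral_prod_mul (incProd (fun x => 1 + f x) n)
          (fun ω : ℕ → G => (1 + f (ω 0)) * f (ω 0)), ih, integral_incProd,
        integral_comp_eval μ (fun x => 1 + f x), integral_comp_eval μ (fun x => (1 + f x) * f x),
        hr1, hrf]
      push_cast
      ring
  have mW := memLp_incProd (μ := μ) hr 2 n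
  have mS := memLp_incSum (μ := μ) hf 2 n
  have m1 : MemLp (fun _ : ℕ → G => (1 : ℝ)) 2 (pathMeasure μ) := memLp_const 1
  have mWS : MemLp (fun ω => incProd (fun x => 1 + f x) n ω + (-1) * incSum f n ω) 2
      (pathMeasure μ) := mW.add (mS.const_mul _)
  have e1 : ∫ ω, incProd (fun x => 1 + f x) n ω + (-1) * incSum f n ω ∂(pathMeasure μ) = 1 := by
    rw [integral_add (mW.integrable one_le_two) ((mS.integrable one_le_two).const_mul _),
      integral_incProd, hr1, integral_const_mul, integral_incSum hf, hf0]
    simp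
  have e : (fun ω => (incProd (fun x => 1 + f x) n ω - 1 - incSum f n ω) ^ 2) = fun ω =>
      (incProd (fun x => 1 + f x) n ω + (-1) * incSum f n ω + (-1) * 1) ^ 2 := by
    ext ω; ring
  rw [e, integral_add_mul_sq mWS m1, integral_add_mul_sq mW mS, hWS, integral_incProd_sq, hr2,
    integral_incSum_sq hf hf0]
  simp only [mul_one]
  rw [e1]
  simp
  ring

/-- From `(1 + q) ^ n ≤ exp (n q)` and `|exp x - 1 - x| ≤ x²` for `|x| ≤ 1`. With `f` of order `t`
the `L²` error is of order `n t²`. -/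
theorem integral_incProd_sub_sq_le (hf : ∀ a, |f a| ≤ C) (hf0 : ∫ x, f x ∂μ.toMeasure = 0) {n : ℕ}
    (hn : n * ∫ x, f x ^ 2 ∂μ.toMeasure ≤ 1) :
    ∫ ω, (incProd (fun x => 1 + f x) n ω - 1 - incSum f n ω) ^ 2 ∂(pathMeasure μ) ≤
      (n * ∫ x, f x ^ 2 ∂μ.toMeasure) ^ 2 := by
  rw [integral_incProd_sub_sq hf hf0]
  set q := ∫ x, f x ^ 2 ∂μ.toMeasure with hq
  have hq0 : 0 ≤ q := integral_nonneg fun _ => sq_nonneg _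
  have h1 : (1 + q) ^ n ≤ Real.exp (n * q) := by
    rw [Real.exp_nat_mul, add_comm]
    exact pow_le_pow_left₀ (by positivity) (Real.add_one_le_exp q) n
  have hnq : 0 ≤ n * q := by positivity
  have h2 := (abs_le.1 (Real.abs_exp_sub_one_sub_id_le (x := n * q) (by rwa [abs_of_nonneg hnq]))).2
  linarith

end Increments

/-! ### Variance of the distance and its covariance with sums. -/

section Fluctuations

variable {G : Type*} [Group G] [Countable G] [MetricSpace G] [IsIsometricSMul G G]
  [MeasurableSpace G] [DiscreteMeasurableSpace G] {μ : PMF G}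

theorem memLp_dist_Z_sub (hμ : HasFiniteMoment 2 μ) (n : ℕ) :
    MemLp (fun ω : ℕ → G => dist (1 : G) (Z n ω) - meanDist μ n) 2 (pathMeasure μ) :=
  (memLp_dist_Z hμ n).sub (memLp_const _)

theorem integral_dist_Z_sub (hμ : HasFiniteMoment 2 μ) (n : ℕ) :
    ∫ ω, (dist (1 : G) (Z n ω) - meanDist μ n) ∂(pathMeasure μ) = 0 := by
  rw [integral_sub (integrable_dist_Z hμ n) (integrable_const _)]
  simp [meanDist]

/-- The variance of the distance to the identity grows at most linearly. -/
theorem exists_sqrt_variance_le (hμ : HasFiniteMoment 2 μ) (hdev : Deviation 2 μ) :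
    ∃ A : ℝ, ∀ n : ℕ,
      √(∫ ω, (dist (1 : G) (Z n ω) - meanDist μ n) ^ 2 ∂(pathMeasure μ)) ≤ A * √n := by
  obtain ⟨τ, hτ⟩ := hdev
  refine exists_le_mul_sqrt (c := 2 * √τ) (by positivity) (fun n => Real.sqrt_nonneg _)
    (by simp [Z, meanDist]) fun n m => ?_
  have hc := measurePreserving_concat μ n
  rw [Real.sq_sqrt (integral_nonneg fun _ => sq_nonneg _),
    Real.sq_sqrt (integral_nonneg fun _ => sq_nonneg _)]
  set g := ∫ ω, pathProd n m ω ∂(pathMeasure μ) with hg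
  have mX := memLp_dist_Z_sub hμ n
  have mY := memLp_dist_Z_sub hμ m
  have mg : MemLp (fun ω : ℕ → G => pathProd n m ω - g) 2 (pathMeasure μ) :=
    (memLp_pathProd hμ n m).sub (memLp_const _)
  have mXY : MemLp (fun p : (ℕ → G) × (ℕ → G) => dist (1 : G) (Z n p.1) - meanDist μ n +
      (dist (1 : G) (Z m p.2) - meanDist μ m)) 2 ((pathMeasure μ).prod (pathMeasure μ)) :=
    (mX.comp_fst _).add (mY.comp_snd _)
  -- The two centred halves are independent, so their variances add; the centred Gromov product adds
  -- at most `2√τ` to the standard deviation, by Minkowski.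
  have e : ∀ p : (ℕ → G) × (ℕ → G),
      dist (1 : G) (Z (n + m) (concat n p)) - meanDist μ (n + m) =
      dist (1 : G) (Z n p.1) - meanDist μ n + (dist (1 : G) (Z m p.2) - meanDist μ m) +
        (-2) * (pathProd n m (concat n p) - g) := by
    intro p
    rw [dist_Z_concat, meanDist_add hμ]
    ring
  rw [← hc.integral_comp_of_aestronglyMeasurable
    (((measurable_dist_Z _).sub_const _).pow_const 2).aestronglyMeasurable]
  simp_rw [e]
  have hM := integral_add_mul_sq_le mXY (mg.comp_measurePreserving hc) (-2)
  have hXY : ∫ p : (ℕ → G) × (ℕ → G), (dist (1 : G) (Z n p.1) - meanDist μ n +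
      (dist (1 : G) (Z m p.2) - meanDist μ m)) ^ 2 ∂((pathMeasure μ).prod (pathMeasure μ)) =
      ∫ ω, (dist (1 : G) (Z n ω) - meanDist μ n) ^ 2 ∂(pathMeasure μ) +
      ∫ ω, (dist (1 : G) (Z m ω) - meanDist μ m) ^ 2 ∂(pathMeasure μ) := by
    simp_rw [sq]
    rw [integral_prod_add_mul_add mX mX mY mY, integral_dist_Z_sub hμ]
    ring
  have hgsq : ∫ p : (ℕ → G) × (ℕ → G), (pathProd n m (concat n p) - g) ^ 2
      ∂((pathMeasure μ).prod (pathMeasure μ)) ≤ τ := by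
    rw [hc.integral_comp_of_aestronglyMeasurable (g := fun ω => (pathProd n m ω - g) ^ 2)
      (((measurable_pathProd n m).sub_const g).pow_const 2).aestronglyMeasurable]
    exact (integral_sub_integral_sq_le (memLp_pathProd hμ n m)).trans
      (integral_pathProd_sq_le hτ n m)
  rw [hXY] at hM
  refine (Real.sqrt_le_sqrt hM).trans ?_
  rw [Real.sqrt_sq (by positivity), abs_neg, abs_two]
  gcongr
  exact hgsq

variable {f : G → ℝ} {C : ℝ}

/-- The cross terms vanish because `f` is centred. The remaining defect pairs the Gromov product, of
`L²` norm at most `√τ`, with a centred sum, of `L²` norm `O(√(n + m))`. -/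
theorem exists_tendsto_integral_dist_Z_mul_incSum (hμ : HasFiniteMoment 2 μ)
    (hdev : Deviation 2 μ) (hf : ∀ a, |f a| ≤ C) (hf0 : ∫ x, f x ∂μ.toMeasure = 0) :
    ∃ σ : ℝ, Tendsto (fun n : ℕ => 1 / (n : ℝ) *
      ∫ ω, dist (1 : G) (Z n ω) * incSum f n ω ∂(pathMeasure μ)) atTop (𝓝 σ) := by
  obtain ⟨τ, hτ⟩ := hdev
  refine exists_tendsto_div_of_almost_additive
    (K := 2 * (√τ * √(∫ x, f x ^ 2 ∂μ.toMeasure))) fun n m => ?_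
  have hc := measurePreserving_concat μ n
  have mX := memLp_dist_Z hμ n
  have mY := memLp_dist_Z hμ m
  have mg := memLp_pathProd hμ n m
  have mS := memLp_incSum (μ := μ) hf 2 (n + m)
  have i1 : Integrable (fun p : (ℕ → G) × (ℕ → G) =>
      (dist (1 : G) (Z n p.1) + dist (1 : G) (Z m p.2)) * (incSum f n p.1 + incSum f m p.2))
      ((pathMeasure μ).prod (pathMeasure μ)) :=
    ((mX.comp_fst _).add (mY.comp_snd _)).integrable_mul
      (((memLp_incSum hf 2 n).comp_fst _).add ((memLp_incSum hf 2 m).comp_snd _))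
  have i2 : Integrable (fun p : (ℕ → G) × (ℕ → G) =>
      2 * (pathProd n m (concat n p) * incSum f (n + m) (concat n p)))
      ((pathMeasure μ).prod (pathMeasure μ)) :=
    (hc.integrable_comp_of_integrable (mg.integrable_mul mS)).const_mul 2
  have e : ∀ p : (ℕ → G) × (ℕ → G),
      dist (1 : G) (Z (n + m) (concat n p)) * incSum f (n + m) (concat n p) =
      (dist (1 : G) (Z n p.1) + dist (1 : G) (Z m p.2)) * (incSum f n p.1 + incSum f m p.2) -
        2 * (pathProd n m (concat n p) * incSum f (n + m) (concat n p)) := by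
    intro p
    rw [dist_Z_concat, incSum_concat]
    ring
  rw [← hc.integral_comp_of_aestronglyMeasurable
    (g := fun ω => dist (1 : G) (Z (n + m) ω) * incSum f (n + m) ω)
    ((measurable_dist_Z _).mul (measurable_incSum f _)).aestronglyMeasurable]
  simp_rw [e]
  rw [integral_sub i1 i2, integral_const_mul,
    hc.integral_comp_of_aestronglyMeasurable
      (g := fun ω => pathProd n m ω * incSum f (n + m) ω)
      ((measurable_pathProd n m).mul (measurable_incSum f _)).aestronglyMeasurable,
    integral_prod_add_mul_add mX (memLp_incSum hf 2 n) mY (memLp_incSum hf 2 m),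
    integral_incSum hf, integral_incSum hf, hf0]
  have hCS := abs_integral_mul_le_sqrt mg mS
  rw [integral_incSum_sq hf hf0, mul_comm ((n + m : ℕ) : ℝ),
    Real.sqrt_mul (integral_nonneg fun _ => sq_nonneg _)] at hCS
  have hg : √(∫ ω, pathProd n m ω ^ 2 ∂(pathMeasure μ)) ≤ √τ :=
    Real.sqrt_le_sqrt (integral_pathProd_sq_le hτ n m)
  have h2 := mul_le_mul_of_nonneg_right hg (mul_nonneg
    (Real.sqrt_nonneg (∫ x, f x ^ 2 ∂μ.toMeasure)) (Real.sqrt_nonneg ((n + m : ℕ) : ℝ)))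
  have h3 := hCS.trans h2
  rw [abs_le] at h3 ⊢
  constructor <;> linarith

end Fluctuations

/-! ### Change of measure along the walk. -/

section ChangeOfMeasure

variable {G : Type*}

open Classical in
/-- The density of `μ'` with respect to `μ`, extended by `1` outside the support of `μ`. -/
noncomputable def relDensity (μ' μ : PMF G) (a : G) : ℝ :=
  if μ a = 0 then 1 else (μ' a).toReal / (μ a).toReal

theorem relDensity_nonneg (μ' μ : PMF G) (a : G) : 0 ≤ relDensity μ' μ a := by
  unfold relDensity; split_ifs <;> positivity

theorem ofReal_relDensity_mul {μ' μ : PMF G} (h : μ'.support = μ.support) (a : G) :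
    ENNReal.ofReal (relDensity μ' μ a) * μ a = μ' a := by
  by_cases ha : μ a = 0
  · have : μ' a = 0 := by
      rw [PMF.apply_eq_zero_iff, h, ← PMF.apply_eq_zero_iff, ha]
    rw [ha, this, mul_zero]
  · have h0 : 0 < (μ a).toReal := ENNReal.toReal_pos ha (μ.apply_ne_top a)
    rw [relDensity, if_neg ha]
    nth_rewrite 2 [← ENNReal.ofReal_toReal (μ.apply_ne_top a)]
    rw [← ENNReal.ofReal_mul (by positivity), div_mul_cancel₀ _ h0.ne',
      ENNReal.ofReal_toReal (μ'.apply_ne_top a)]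

variable [MeasurableSpace G] [DiscreteMeasurableSpace G] [Countable G]

theorem lintegral_eq_lintegral_mul_relDensity {μ' μ : PMF G} (h : μ'.support = μ.support)
    (F : G → ℝ≥0∞) :
    ∫⁻ x, F x ∂μ'.toMeasure = ∫⁻ x, F x * ENNReal.ofReal (relDensity μ' μ x) ∂μ.toMeasure := by
  rw [lintegral_pmf, lintegral_pmf]
  exact tsum_congr fun x => by rw [mul_assoc, ofReal_relDensity_mul h]

theorem integral_relDensity {μ' μ : PMF G} (h : μ'.support = μ.support) :
    ∫ x, relDensity μ' μ x ∂μ.toMeasure = 1 := by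
  rw [integral_eq_lintegral_of_nonneg_ae (ae_of_all _ (relDensity_nonneg μ' μ))
    Measurable.of_discrete.aestronglyMeasurable]
  have := lintegral_eq_lintegral_mul_relDensity h fun _ => 1
  simp only [one_mul] at this
  simp [← this]

/-- Only functions of the endpoint are needed. Integrating out the last increment replaces `F` by
its one-step average, which is why the induction must hold for all `F`; with values in `[0, ∞]` no
integrability is needed. -/
theorem lintegral_Z_eq [Group G] {μ' μ : PMF G} (h : μ'.support = μ.support) (n : ℕ)
    (F : G → ℝ≥0∞) :
    ∫⁻ ω, F (Z n ω) ∂(pathMeasure μ') =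
      ∫⁻ ω, F (Z n ω) * ENNReal.ofReal (incProd (relDensity μ' μ) n ω) ∂(pathMeasure μ) := by
  induction n generalizing F with
  | zero => simp [Z, incProd]
  | succ n ih =>
    have hZ : ∀ p : (ℕ → G) × (ℕ → G), Z (n + 1) (concat n p) = Z n p.1 * p.2 0 := fun p => by
      rw [Z_concat]; simp [Z]
    have mF : Measurable F := Measurable.of_discrete
    have mm : Measurable fun p : G × G => p.1 * p.2 := Measurable.of_discrete
    have mW : ∀ n, Measurable fun ω => ENNReal.ofReal (incProd (relDensity μ' μ) n ω) := fun n =>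
      (measurable_incProd _ n).ennreal_ofReal
    have m0 : Measurable fun p : (ℕ → G) × (ℕ → G) => p.2 0 :=
      (measurable_pi_apply 0).comp measurable_snd
    have mZ : Measurable fun p : (ℕ → G) × (ℕ → G) => Z n p.1 * p.2 0 :=
      mm.comp (((measurable_Z n).comp measurable_fst).prodMk m0)
    rw [← (measurePreserving_concat μ' n).lintegral_comp (f := fun ω => F (Z (n + 1) ω))
        (mF.comp (measurable_Z (n + 1))),
      ← (measurePreserving_concat μ n).lintegral_comp
        (f := fun ω => F (Z (n + 1) ω) * ENNReal.ofReal (incProd (relDensity μ' μ) (n + 1) ω))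
        ((mF.comp (measurable_Z (n + 1))).mul (mW (n + 1)))]
    simp only [hZ, incProd_concat_one]
    rw [lintegral_prod (fun p : (ℕ → G) × (ℕ → G) => F (Z n p.1 * p.2 0))
      (mF.comp mZ).aemeasurable, lintegral_prod (fun p : (ℕ → G) × (ℕ → G) =>
        F (Z n p.1 * p.2 0) * ENNReal.ofReal (incProd (relDensity μ' μ) n p.1 *
          relDensity μ' μ (p.2 0))) (((mF.comp mZ).mul
      (((measurable_incProd _ n).comp measurable_fst).mul
        ((Measurable.of_discrete (f := relDensity μ' μ)).comp m0)).ennreal_ofReal).aemeasurable)]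
    have e1 : ∀ z : G, ∫⁻ ω, F (z * ω 0) ∂(pathMeasure μ') =
        ∫⁻ x, F (z * x) * ENNReal.ofReal (relDensity μ' μ x) ∂μ.toMeasure := fun z => by
      rw [(measurePreserving_eval μ' 0).lintegral_comp (f := fun x => F (z * x))
        Measurable.of_discrete, lintegral_eq_lintegral_mul_relDensity h]
    have e2 : ∀ ω : ℕ → G, ∫⁻ ω', F (Z n ω * ω' 0) * ENNReal.ofReal
        (incProd (relDensity μ' μ) n ω * relDensity μ' μ (ω' 0)) ∂(pathMeasure μ) =
        (∫⁻ x, F (Z n ω * x) * ENNReal.ofReal (relDensity μ' μ x) ∂μ.toMeasure) *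
          ENNReal.ofReal (incProd (relDensity μ' μ) n ω) := fun ω => by
      rw [← lintegral_mul_const _ Measurable.of_discrete,
        ← (measurePreserving_eval μ 0).lintegral_comp (f := fun x => F (Z n ω * x) *
          ENNReal.ofReal (relDensity μ' μ x) * ENNReal.ofReal (incProd (relDensity μ' μ) n ω))
          Measurable.of_discrete]
      refine lintegral_congr fun ω' => ?_
      rw [mul_comm (incProd _ _ _), ENNReal.ofReal_mul (relDensity_nonneg _ _ _), mul_assoc]
    simp_rw [e1, e2]
    exact ih fun z => ∫⁻ x, F (z * x) * ENNReal.ofReal (relDensity μ' μ x) ∂μ.toMeasure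

theorem meanDist_eq_integral_mul_incProd [Group G] [MetricSpace G] {μ' μ : PMF G}
    (h : μ'.support = μ.support) (n : ℕ) :
    meanDist μ' n =
      ∫ ω, dist (1 : G) (Z n ω) * incProd (relDensity μ' μ) n ω ∂(pathMeasure μ) := by
  have hW : ∀ ω, 0 ≤ incProd (relDensity μ' μ) n ω := fun ω =>
    Finset.prod_nonneg fun j _ => relDensity_nonneg _ _ _
  rw [meanDist, integral_eq_lintegral_of_nonneg_ae (ae_of_all _ fun ω => dist_nonneg)
    (measurable_dist_Z n).aestronglyMeasurable,
    integral_eq_lintegral_of_nonneg_ae (ae_of_all _ fun ω => mul_nonneg dist_nonneg (hW ω))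
    ((measurable_dist_Z n).mul (measurable_incProd _ n)).aestronglyMeasurable,
    lintegral_Z_eq h n fun z => ENNReal.ofReal (dist 1 z)]
  simp_rw [ENNReal.ofReal_mul dist_nonneg]

end ChangeOfMeasure

/-! ### Comparison of two walks at a finite time. -/

section Comparison

variable {G : Type*} [Group G] [Countable G] [MetricSpace G] [IsIsometricSMul G G]
  [MeasurableSpace G] [DiscreteMeasurableSpace G] {μ μ' : PMF G}

/-- The two error terms come from Cauchy–Schwarz, applied to the nonlinear part of the weight and to
the sum of `φ - f`. Both are paired with the centred distance, which has size `√n` and not `n`. -/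
theorem abs_meanDist_sub_sub_le (hμ : HasFiniteMoment 2 μ) (hsupp : μ'.support = μ.support)
    {A : ℝ} {n : ℕ}
    (hA : √(∫ ω, (dist (1 : G) (Z n ω) - meanDist μ n) ^ 2 ∂(pathMeasure μ)) ≤ A * √n)
    {t M C : ℝ} (ht : 0 ≤ t) {φ f : G → ℝ} (hφ : ∀ a, relDensity μ' μ a = 1 + t * φ a)
    (hφM : ∀ a, |φ a| ≤ M) (hfC : ∀ a, |f a| ≤ C) (hφ0 : ∫ x, φ x ∂μ.toMeasure = 0)
    (hf0 : ∫ x, f x ∂μ.toMeasure = 0) (hn : n * (t ^ 2 * M ^ 2) ≤ 1) :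
    |meanDist μ' n - meanDist μ n -
        t * ∫ ω, dist (1 : G) (Z n ω) * incSum f n ω ∂(pathMeasure μ)| ≤
      A * √n * (n * (t ^ 2 * M ^ 2)) +
        t * (A * √n * (√n * √(∫ x, (φ x - f x) ^ 2 ∂μ.toMeasure))) := by
  set W := incProd (fun x => 1 + t * φ x) n with hW
  have hM0 : 0 ≤ M := (abs_nonneg _).trans (hφM 1)
  have htφ : ∀ a, |t * φ a| ≤ t * M := fun a => by
    rw [abs_mul, abs_of_nonneg ht]; exact mul_le_mul_of_nonneg_left (hφM a) ht
  have htφ0 : ∫ x, t * φ x ∂μ.toMeasure = 0 := by rw [integral_const_mul, hφ0, mul_zero]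
  have hr : ∀ a, |1 + t * φ a| ≤ 1 + t * M := fun a =>
    (abs_add_le _ _).trans (by rw [abs_one]; exact add_le_add_right (htφ a) 1)
  have hδ : ∀ a, |φ a - f a| ≤ M + C := fun a =>
    (abs_sub _ _).trans (add_le_add (hφM a) (hfC a))
  have iφ : Integrable φ μ.toMeasure := (memLp_of_bounded hφM 1 μ).integrable le_rfl
  have i_f : Integrable f μ.toMeasure := (memLp_of_bounded hfC 1 μ).integrable le_rfl
  have hδ0 : ∫ x, (φ x - f x) ∂μ.toMeasure = 0 := by
    rw [integral_sub iφ i_f, hφ0, hf0, sub_zero]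
  have hr1 : ∫ x, (1 + t * φ x) ∂μ.toMeasure = 1 := by
    rw [integral_add (integrable_const 1) (iφ.const_mul t), htφ0]; simp
  have hW1 : ∫ ω, W ω ∂(pathMeasure μ) = 1 := by rw [hW, integral_incProd, hr1, one_pow]
  have mD := memLp_dist_Z_sub hμ n
  have md := memLp_dist_Z hμ n
  have mW : MemLp W 2 (pathMeasure μ) := memLp_incProd hr 2 n
  have ms : MemLp (incSum (fun x => t * φ x) n) 2 (pathMeasure μ) := memLp_incSum htφ 2 n
  have mf : MemLp (incSum f n) 2 (pathMeasure μ) := memLp_incSum hfC 2 n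
  have mδ : MemLp (incSum (fun x => φ x - f x) n) 2 (pathMeasure μ) := memLp_incSum hδ 2 n
  have mU : MemLp (fun ω => W ω - 1 - incSum (fun x => t * φ x) n ω) 2 (pathMeasure μ) :=
    (mW.sub (memLp_const 1)).sub ms
  have hq : ∫ x, (t * φ x) ^ 2 ∂μ.toMeasure ≤ t ^ 2 * M ^ 2 := by
    have := integral_mono (μ := μ.toMeasure) (memLp_of_bounded htφ 2 μ).integrable_sq
      (integrable_const ((t * M) ^ 2)) fun x => sq_le_sq' (neg_le_of_abs_le (htφ x))
        (le_of_abs_le (htφ x))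
    simpa [mul_pow] using this
  have hnq : n * ∫ x, (t * φ x) ^ 2 ∂μ.toMeasure ≤ n * (t ^ 2 * M ^ 2) :=
    mul_le_mul_of_nonneg_left hq n.cast_nonneg
  have hnq0 : 0 ≤ n * ∫ x, (t * φ x) ^ 2 ∂μ.toMeasure :=
    mul_nonneg n.cast_nonneg (integral_nonneg fun _ => sq_nonneg _)
  have hU : √(∫ ω, (W ω - 1 - incSum (fun x => t * φ x) n ω) ^ 2 ∂(pathMeasure μ)) ≤
      n * (t ^ 2 * M ^ 2) :=
    Real.sqrt_le_iff.2 ⟨hnq0.trans hnq,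
      (integral_incProd_sub_sq_le htφ htφ0 (hnq.trans hn)).trans (pow_le_pow_left₀ hnq0 hnq 2)⟩
  have h1 := (abs_integral_mul_le_sqrt mD mU).trans
    (mul_le_mul hA hU (Real.sqrt_nonneg _) ((Real.sqrt_nonneg _).trans hA))
  have h2 := (abs_integral_mul_le_sqrt mD mδ).trans
    (mul_le_mul_of_nonneg_right hA (Real.sqrt_nonneg _))
  rw [integral_incSum_sq hδ hδ0, Real.sqrt_mul n.cast_nonneg] at h2
  have iDU : Integrable (fun ω => (dist (1 : G) (Z n ω) - meanDist μ n) *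
      (W ω - 1 - incSum (fun x => t * φ x) n ω)) (pathMeasure μ) := mD.integrable_mul mU
  have iDδ : Integrable (fun ω => t * ((dist (1 : G) (Z n ω) - meanDist μ n) *
      incSum (fun x => φ x - f x) n ω)) (pathMeasure μ) := (mD.integrable_mul mδ).const_mul t
  have idW : Integrable (fun ω => dist (1 : G) (Z n ω) * W ω) (pathMeasure μ) :=
    md.integrable_mul mW
  have idS : Integrable (fun ω => t * (dist (1 : G) (Z n ω) * incSum f n ω)) (pathMeasure μ) :=
    (md.integrable_mul mf).const_mul t
  have i_d := integrable_dist_Z hμ n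
  have iW : Integrable (fun ω => meanDist μ n * (W ω - 1 - t * incSum f n ω)) (pathMeasure μ) :=
    (((mW.integrable one_le_two).sub (integrable_const 1)).sub
      ((mf.integrable one_le_two).const_mul t)).const_mul _
  -- Centring the distance is free: `W` has mean `1` and the sum of `f` has mean `0`.
  have hzero : ∫ ω, meanDist μ n * (W ω - 1 - t * incSum f n ω) ∂(pathMeasure μ) = 0 := by
    have iW1 : Integrable (fun ω => W ω - 1) (pathMeasure μ) :=
      (mW.integrable one_le_two).sub (integrable_const 1)
    rw [integral_const_mul, integral_sub iW1 ((mf.integrable one_le_two).const_mul t),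
      integral_sub (mW.integrable one_le_two) (integrable_const 1), hW1, integral_const_mul,
      integral_incSum hfC, hf0]
    simp
  have idWd : Integrable (fun ω => dist (1 : G) (Z n ω) * W ω - dist (1 : G) (Z n ω))
      (pathMeasure μ) := idW.sub i_d
  have idWdS : Integrable (fun ω => dist (1 : G) (Z n ω) * W ω - dist (1 : G) (Z n ω) -
      t * (dist (1 : G) (Z n ω) * incSum f n ω)) (pathMeasure μ) := idWd.sub idS
  have hs : ∀ ω : ℕ → G, t * incSum (fun x => φ x - f x) n ω =
      incSum (fun x => t * φ x) n ω - t * incSum f n ω := fun ω => by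
    simp only [incSum, Finset.mul_sum, ← Finset.sum_sub_distrib, mul_sub]
  have key : meanDist μ' n - meanDist μ n -
        t * ∫ ω, dist (1 : G) (Z n ω) * incSum f n ω ∂(pathMeasure μ) =
      ∫ ω, (dist (1 : G) (Z n ω) - meanDist μ n) *
        (W ω - 1 - incSum (fun x => t * φ x) n ω) ∂(pathMeasure μ) +
      t * ∫ ω, (dist (1 : G) (Z n ω) - meanDist μ n) *
        incSum (fun x => φ x - f x) n ω ∂(pathMeasure μ) := by
    rw [meanDist_eq_integral_mul_incProd hsupp, show relDensity μ' μ = fun x => 1 + t * φ x from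
      funext hφ, ← hW, ← integral_const_mul, ← integral_const_mul, ← integral_add iDU iDδ]
    nth_rewrite 1 [meanDist]
    rw [← integral_sub idW i_d, ← integral_sub idWd idS, ← sub_zero (∫ ω, _ ∂(pathMeasure μ)),
      ← hzero, ← integral_sub idWdS iW]
    congr 1
    ext ω
    linear_combination (meanDist μ n - dist (1 : G) (Z n ω)) * hs ω
  rw [key]
  refine (abs_add_le _ _).trans (add_le_add h1 ?_)
  rw [abs_mul, abs_of_nonneg ht]
  exact mul_le_mul_of_nonneg_left h2 ht

/-- Replacing `n ℓ` by the mean distance costs `2τ` for each of the two walks; the rest is the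
finite-time comparison divided by `t n`. -/
theorem abs_rateOfEscape_slope_sub_le (hμ : HasFiniteMoment 2 μ) (hμ' : HasFiniteMoment 2 μ')
    (hsupp : μ'.support = μ.support) {τ : ℝ≥0} (hdev : DeviationWith 1 τ μ)
    (hdev' : DeviationWith 1 τ μ') {A : ℝ} {n : ℕ} (hn0 : n ≠ 0)
    (hA : √(∫ ω, (dist (1 : G) (Z n ω) - meanDist μ n) ^ 2 ∂(pathMeasure μ)) ≤ A * √n)
    {t M C : ℝ} (ht : 0 < t) {φ f : G → ℝ} (hφ : ∀ a, relDensity μ' μ a = 1 + t * φ a)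
    (hφM : ∀ a, |φ a| ≤ M) (hfC : ∀ a, |f a| ≤ C) (hφ0 : ∫ x, φ x ∂μ.toMeasure = 0)
    (hf0 : ∫ x, f x ∂μ.toMeasure = 0) (hn : n * (t ^ 2 * M ^ 2) ≤ 1) :
    |1 / t * (rateOfEscape μ' - rateOfEscape μ) -
        1 / (n : ℝ) * ∫ ω, dist (1 : G) (Z n ω) * incSum f n ω ∂(pathMeasure μ)| ≤
      4 * τ / (t * n) + A * M ^ 2 * √(n * t ^ 2) + A * √(∫ x, (φ x - f x) ^ 2 ∂μ.toMeasure) := by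
  have h := abs_meanDist_sub_sub_le hμ hsupp hA ht.le hφ hφM hfC hφ0 hf0 hn
  have h1 := abs_meanDist_sub_le hμ hdev hn0
  have h2 := abs_meanDist_sub_le hμ' hdev' hn0
  set c := ∫ ω, dist (1 : G) (Z n ω) * incSum f n ω ∂(pathMeasure μ)
  set e := √(∫ x, (φ x - f x) ^ 2 ∂μ.toMeasure)
  have hn' : (0 : ℝ) < n := by positivity
  have hsn : √(n : ℝ) * √n = n := Real.mul_self_sqrt hn'.le
  have e1 : 1 / t * (rateOfEscape μ' - rateOfEscape μ) - 1 / (n : ℝ) * c =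
      ((meanDist μ' n - meanDist μ n - t * c) - (meanDist μ' n - n * rateOfEscape μ')
        + (meanDist μ n - n * rateOfEscape μ)) / (t * n) := by
    field_simp; ring
  rw [e1, abs_div, abs_of_pos (mul_pos ht hn'), div_le_iff₀ (mul_pos ht hn'),
    Real.sqrt_mul n.cast_nonneg, Real.sqrt_sq ht.le]
  have e2 : (4 * τ / (t * n) + A * M ^ 2 * (√n * t) + A * e) * (t * n) =
      4 * τ + A * √n * (n * (t ^ 2 * M ^ 2)) + t * (A * (√n * √n) * e) := by
    rw [hsn]; field_simp
  rw [e2]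
  refine (abs_add_le _ _).trans ((add_le_add_left (abs_sub _ _) _).trans ?_)
  linarith

end Comparison

/-! ### Nearby measures, supports and bounded convergence. -/

section Neighbourhood

variable {G : Type*} {μ μ' : PMF G}

theorem mem_nhd_of_le_mul {c K : ℝ} (hsupp : μ'.support = μ.support) (hc : 0 ≤ c)
    (hK : c - 1 ≤ K) (h1 : ∀ a ∈ μ.support, (μ' a).toReal ≤ c * (μ a).toReal)
    (h2 : ∀ a ∈ μ.support, (μ a).toReal ≤ c * (μ' a).toReal) : μ' ∈ nhd μ K := by
  have aux : ∀ p q : PMF G, ∀ a, (p a).toReal ≤ c * (q a).toReal →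
      p a / q a ≤ ENNReal.ofReal c := by
    intro p q a h
    refine ENNReal.div_le_of_le_mul ?_
    rw [← ENNReal.ofReal_toReal (p.apply_ne_top a), ← ENNReal.ofReal_toReal (q.apply_ne_top a),
      ← ENNReal.ofReal_mul hc]
    exact ENNReal.ofReal_le_ofReal h
  refine ⟨hsupp, iSup₂_le fun a ha => ?_⟩
  calc max (μ' a / μ a) (μ a / μ' a) - 1 ≤ ENNReal.ofReal c - 1 :=
        tsub_le_tsub_right (max_le (aux _ _ a (h1 a ha)) (aux _ _ a (h2 a ha))) 1
    _ = ENNReal.ofReal (c - 1) := by rw [ENNReal.ofReal_sub _ zero_le_one, ENNReal.ofReal_one]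
    _ ≤ ENNReal.ofReal K := ENNReal.ofReal_le_ofReal hK

theorem HasFiniteMoment.of_le_mul [Group G] [MetricSpace G] {p : ℝ} (hμ : HasFiniteMoment p μ)
    {c : ℝ} (h : ∀ a, (μ' a).toReal ≤ c * (μ a).toReal) : HasFiniteMoment p μ' := by
  refine Summable.of_nonneg_of_le (fun x => by positivity) (fun x => ?_) (hμ.mul_left c)
  rw [mul_left_comm]
  exact mul_le_mul_of_nonneg_left (h x) (by positivity)

theorem ae_mem_support [MeasurableSpace G] [DiscreteMeasurableSpace G] (μ : PMF G) :
    ∀ᵐ x ∂μ.toMeasure, x ∈ μ.support := by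
  rw [ae_iff, PMF.toMeasure_apply_eq_zero_iff _ (MeasurableSet.of_discrete)]
  exact Set.disjoint_left.2 fun x hx hx' => hx' hx

theorem ae_forall_mem_support [MeasurableSpace G] [DiscreteMeasurableSpace G] (μ : PMF G) :
    ∀ᵐ ω ∂(pathMeasure μ), ∀ j, ω j ∈ μ.support :=
  ae_all_iff.2 fun j => (measurePreserving_eval μ j).quasiMeasurePreserving.ae (ae_mem_support μ)

/-- Bounded convergence for functions on a discrete space. -/
theorem tendsto_integral_of_bounded [MeasurableSpace G] [DiscreteMeasurableSpace G] (μ : PMF G)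
    {l : Filter ℝ} [l.IsCountablyGenerated] {F : ℝ → G → ℝ} {f : G → ℝ} {C : ℝ}
    (hF : ∀ᶠ t in l, ∀ a, |F t a| ≤ C) (hlim : ∀ a, Tendsto (fun t => F t a) l (𝓝 (f a))) :
    Tendsto (fun t => ∫ x, F t x ∂μ.toMeasure) l (𝓝 (∫ x, f x ∂μ.toMeasure)) :=
  tendsto_integral_filter_of_dominated_convergence (fun _ => C)
    (Eventually.of_forall fun _ => Measurable.of_discrete.aestronglyMeasurable)
    (hF.mono fun _ ht => ae_of_all _ ht) (integrable_const _) (ae_of_all _ hlim)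

end Neighbourhood

theorem abs_exp_sub_one_le_mul_exp (x : ℝ) : |Real.exp x - 1| ≤ |x| * Real.exp |x| := by
  rcases le_total 0 x with hx | hx
  · have h1 := Real.add_one_le_exp (-x)
    have h2 : Real.exp (-x) * Real.exp x = 1 := by rw [← Real.exp_add]; simp
    rw [abs_of_nonneg hx, abs_of_nonneg (by linarith [Real.one_le_exp hx])]
    nlinarith [mul_le_mul_of_nonneg_right h1 (Real.exp_pos x).le]
  · have h1 := Real.add_one_le_exp x
    rw [abs_of_nonpos hx, abs_of_nonpos (by linarith [Real.exp_le_one_iff.2 hx])]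
    nlinarith [Real.one_le_exp (neg_nonneg.2 hx)]

/-! ### The choice of the time horizon. -/

section Limits

/-- The time horizon used to compare two walks whose increments are at distance `t`. -/
noncomputable def horizon (t : ℝ) : ℕ := ⌈(t * √t)⁻¹⌉₊

theorem tendsto_horizon : Tendsto horizon (𝓝[>] 0) atTop := by
  have h1 : Tendsto (fun t : ℝ => t * √t) (𝓝[>] 0) (𝓝[>] 0) := by
    refine tendsto_nhdsWithin_iff.2 ⟨?_, ?_⟩
    · have : Continuous fun t : ℝ => t * √t := by fun_prop
      simpa using (this.tendsto 0).mono_left nhdsWithin_le_nhds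
    · filter_upwards [self_mem_nhdsWithin] with t ht
      exact mul_pos ht (Real.sqrt_pos.2 ht)
  exact tendsto_nat_ceil_atTop.comp (tendsto_inv_nhdsGT_zero.comp h1)

/-- Removes the error `4τ / (t n)`: the horizon is at least `t ^ (-3/2)`, so `t n ≥ t ^ (-1/2)`. -/
theorem tendsto_inv_mul_horizon :
    Tendsto (fun t : ℝ => (t * horizon t)⁻¹) (𝓝[>] 0) (𝓝 0) := by
  have h1 : Tendsto (fun t : ℝ => √t) (𝓝[>] 0) (𝓝 0) := by
    simpa using (Real.continuous_sqrt.tendsto 0).mono_left nhdsWithin_le_nhds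
  refine squeeze_zero' ?_ ?_ h1
  · filter_upwards [self_mem_nhdsWithin] with t ht
    have : (0 : ℝ) < t := ht
    positivity
  · filter_upwards [self_mem_nhdsWithin] with t ht
    have ht' : (0 : ℝ) < t := ht
    have hs : 0 < √t := Real.sqrt_pos.2 ht
    have h2 : (t * √t)⁻¹ ≤ horizon t := Nat.le_ceil _
    rw [← inv_inv (√t)]
    refine inv_anti₀ (by positivity) ?_
    calc (√t)⁻¹ = t * (t * √t)⁻¹ := by field_simp
      _ ≤ t * horizon t := by gcongr

/-- Removes the error from the nonlinear part of the weight. Any exponent strictly between `-2` and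
`-1` would serve both limits. -/
theorem tendsto_horizon_mul_sq :
    Tendsto (fun t : ℝ => horizon t * t ^ 2) (𝓝[>] 0) (𝓝 0) := by
  have h1 : Tendsto (fun t : ℝ => √t + t ^ 2) (𝓝[>] 0) (𝓝 0) := by
    have : Continuous fun t : ℝ => √t + t ^ 2 := by fun_prop
    simpa using (this.tendsto 0).mono_left nhdsWithin_le_nhds
  refine squeeze_zero' (Eventually.of_forall fun t => by positivity) ?_ h1
  filter_upwards [self_mem_nhdsWithin] with t ht
  have ht' : (0 : ℝ) < t := ht
  have hs : 0 < √t := Real.sqrt_pos.2 ht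
  have h2 : (horizon t : ℝ) < (t * √t)⁻¹ + 1 := Nat.ceil_lt_add_one (by positivity)
  calc (horizon t : ℝ) * t ^ 2 ≤ ((t * √t)⁻¹ + 1) * t ^ 2 := by gcongr
    _ = t / √t + t ^ 2 := by field_simp
    _ = √t + t ^ 2 := by rw [Real.div_sqrt]

end Limits

end RandomWalk

/-! ### The derivative of the rate of escape. -/

open RandomWalk in
theorem mainTheorem7 {G : Type*} [Group G] [Countable G] [MetricSpace G] [IsIsometricSMul G G]
    [MeasurableSpace G] [DiscreteMeasurableSpace G]
    (B : Set G) (μ : PMF G) (hB : μ.support = B)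
    (hmom : RandomWalk.HasFiniteMoment 2 μ)
    (hdev : RandomWalk.Deviation 2 μ)
    (hunif : RandomWalk.LocallyUniformDeviation 1 μ)
    (γ : ℝ → PMF G) (hγB : ∀ t ∈ Set.Icc (0 : ℝ) 1, (γ t).support = B) (hγ0 : γ 0 = μ)
    (ν : G → ℝ)
    (hderiv : ∀ a ∈ B,
      HasDerivWithinAt (fun t : ℝ => Real.log ((γ t a).toReal)) (ν a) (Set.Icc 0 1) 0)
    (hν : ∃ C : ℝ, ∀ a ∈ B, |ν a| ≤ C)
    (hsup : ∃ C : ℝ, ∀ t ∈ Set.Ioc (0 : ℝ) 1, ∀ a ∈ B,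
      |1 / t * Real.log ((γ t a).toReal / (γ 0 a).toReal) - ν a| ≤ C) :
    -- the rates of escape along the curve are well defined
    (∀ t ∈ Set.Icc (0 : ℝ) 1,
      (∀ n : ℕ, Integrable (fun ω => dist (1 : G) (RandomWalk.Z n ω))
        (RandomWalk.pathMeasure (γ t))) ∧
      Tendsto (fun n : ℕ => (1 / (n : ℝ)) *
          ∫ ω, dist (1 : G) (RandomWalk.Z n ω) ∂(RandomWalk.pathMeasure (γ t)))
        atTop (𝓝 (RandomWalk.rateOfEscape (γ t)))) ∧
    -- the covariances are well defined
    (∀ n : ℕ, Integrable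
      (fun ω => dist (1 : G) (RandomWalk.Z n ω) * ∑ j ∈ Finset.range n, ν (ω j))
      (RandomWalk.pathMeasure μ)) ∧
    -- both limits exist and coincide
    ∃ σ : ℝ,
      Tendsto (fun n : ℕ => (1 / (n : ℝ)) *
          ∫ ω, dist (1 : G) (RandomWalk.Z n ω) * ∑ j ∈ Finset.range n, ν (ω j)
            ∂(RandomWalk.pathMeasure μ))
        atTop (𝓝 σ) ∧
      Tendsto (fun t : ℝ => 1 / t * (RandomWalk.rateOfEscape (γ t) - RandomWalk.rateOfEscape μ))
        (𝓝[>] 0) (𝓝 σ) := by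
  subst hB
  obtain ⟨C₁, hC₁⟩ := hν
  obtain ⟨C₂, hC₂⟩ := hsup
  have hpos : ∀ p : PMF G, p.support = μ.support → ∀ a ∈ μ.support, 0 < (p a).toReal :=
    fun p hp a ha => ENNReal.toReal_pos (by rwa [← hp, PMF.mem_support_iff] at ha)
      (p.apply_ne_top a)
  have hsuppt : ∀ t ∈ Set.Ioc (0 : ℝ) 1, (γ t).support = μ.support := fun t ht =>
    hγB t ⟨ht.1.le, ht.2⟩
  set D := |C₁| + |C₂| with hD
  have hD0 : 0 ≤ D := by positivity
  -- the logarithmic density is at most `t * D`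
  have hlog : ∀ t ∈ Set.Ioc (0 : ℝ) 1, ∀ a ∈ μ.support,
      |Real.log ((γ t a).toReal / (μ a).toReal)| ≤ t * D := by
    intro t ht a ha
    have h1 := hC₂ t ht a ha
    rw [hγ0] at h1
    set l := Real.log ((γ t a).toReal / (μ a).toReal)
    have h2 : |1 / t * l| ≤ D := by
      have := abs_add_le (1 / t * l - ν a) (ν a)
      rw [sub_add_cancel] at this
      linarith [hC₁ a ha, le_abs_self C₁, le_abs_self C₂]
    rwa [abs_mul, abs_of_pos (one_div_pos.2 ht.1), one_div_mul_eq_div, div_le_iff₀ ht.1,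
      mul_comm] at h2
  have hexp : ∀ t ∈ Set.Ioc (0 : ℝ) 1, ∀ a ∈ μ.support,
      (γ t a).toReal / (μ a).toReal =
        Real.exp (Real.log ((γ t a).toReal / (μ a).toReal)) := fun t ht a ha =>
    (Real.exp_log (div_pos (hpos _ (hsuppt t ht) a ha) (hpos _ rfl a ha))).symm
  have hle1 : ∀ t ∈ Set.Ioc (0 : ℝ) 1, ∀ a ∈ μ.support,
      (γ t a).toReal ≤ Real.exp (t * D) * (μ a).toReal := by
    intro t ht a ha
    rw [← div_le_iff₀ (hpos _ rfl a ha), hexp t ht a ha]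
    exact Real.exp_le_exp.2 (le_of_abs_le (hlog t ht a ha))
  have hle2 : ∀ t ∈ Set.Ioc (0 : ℝ) 1, ∀ a ∈ μ.support,
      (μ a).toReal ≤ Real.exp (t * D) * (γ t a).toReal := by
    intro t ht a ha
    rw [← div_le_iff₀ (hpos _ (hsuppt t ht) a ha), ← inv_div, hexp t ht a ha, ← Real.exp_neg]
    exact Real.exp_le_exp.2 (neg_le.1 (neg_le_of_abs_le (hlog t ht a ha)))
  have hmomt : ∀ t ∈ Set.Icc (0 : ℝ) 1, HasFiniteMoment 2 (γ t) := by
    intro t ht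
    rcases ht.1.eq_or_lt with rfl | h0
    · rwa [hγ0]
    · refine hmom.of_le_mul (c := Real.exp (t * D)) fun a => ?_
      by_cases ha : a ∈ μ.support
      · exact hle1 t ⟨h0, ht.2⟩ a ha
      · have : a ∉ (γ t).support := by rwa [hγB t ht]
        rw [← PMF.apply_eq_zero_iff] at this
        rw [this]
        simp only [ENNReal.toReal_zero]
        positivity
  -- `ν` and the increments of the densities, extended by zero
  set f : G → ℝ := μ.support.indicator ν with hf
  have hfC : ∀ a, |f a| ≤ |C₁| := by
    intro a
    by_cases ha : a ∈ μ.support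
    · rw [hf, Set.indicator_of_mem ha]; exact (hC₁ a ha).trans (le_abs_self _)
    · rw [hf, Set.indicator_of_notMem ha, abs_zero]; positivity
  -- Nothing bounds `ν` off the support, but almost surely no increment lands there.
  have hae : ∀ n, (fun ω => dist (1 : G) (Z n ω) * incSum f n ω) =ᵐ[pathMeasure μ]
      fun ω => dist (1 : G) (Z n ω) * ∑ j ∈ Finset.range n, ν (ω j) := by
    intro n
    filter_upwards [ae_forall_mem_support μ] with ω hω
    rw [incSum, Finset.sum_congr rfl fun j _ => Set.indicator_of_mem (hω j) ν]
  set φ : ℝ → G → ℝ := fun t a => (relDensity (γ t) μ a - 1) / t with hφ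
  have hφ1 : ∀ t ∈ Set.Ioc (0 : ℝ) 1, ∀ a, relDensity (γ t) μ a = 1 + t * φ t a := by
    intro t ht a
    have := ht.1.ne'
    simp only [hφ]
    field_simp
    ring
  -- The value `1` of `relDensity` off the support makes `φ` vanish there, in agreement with `f`.
  have hφnot : ∀ t, ∀ a ∉ μ.support, φ t a = 0 := by
    intro t a ha
    rw [← PMF.apply_eq_zero_iff] at ha
    simp [hφ, relDensity, ha]
  have hφmem : ∀ t, ∀ a ∈ μ.support, φ t a = ((γ t a).toReal / (μ a).toReal - 1) / t := by
    intro t a ha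
    rw [PMF.mem_support_iff] at ha
    simp [hφ, relDensity, ha]
  set M := D * Real.exp D with hM
  have hφM : ∀ t ∈ Set.Ioc (0 : ℝ) 1, ∀ a, |φ t a| ≤ M := by
    intro t ht a
    by_cases ha : a ∈ μ.support
    · rw [hφmem t a ha, abs_div, abs_of_pos ht.1, div_le_iff₀ ht.1, hexp t ht a ha]
      refine (abs_exp_sub_one_le_mul_exp _).trans ?_
      have h1 := hlog t ht a ha
      have h2 : t * D ≤ D := mul_le_of_le_one_left hD0 ht.2
      calc _ ≤ t * D * Real.exp D :=
            mul_le_mul h1 (Real.exp_le_exp.2 (h1.trans h2)) (Real.exp_pos _).le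
              (mul_nonneg ht.1.le hD0)
        _ = M * t := by rw [hM]; ring
    · rw [hφnot t a ha, abs_zero]; positivity
  have hφ0 : ∀ t ∈ Set.Ioc (0 : ℝ) 1, ∫ x, φ t x ∂μ.toMeasure = 0 := by
    intro t ht
    have hφi : Integrable (fun x => t * φ t x) μ.toMeasure :=
      ((memLp_of_bounded (hφM t ht) 1 μ).integrable le_rfl).const_mul t
    have h1 := integral_relDensity (hsuppt t ht)
    simp_rw [hφ1 t ht] at h1
    rw [integral_add (integrable_const 1) hφi, integral_const_mul] at h1
    simpa [ht.1.ne'] using h1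
  have hIoc : ∀ᶠ t : ℝ in 𝓝[>] 0, t ∈ Set.Ioc (0 : ℝ) 1 := Ioc_mem_nhdsGT one_pos
  have hφlim : ∀ a, Tendsto (fun t => φ t a) (𝓝[>] 0) (𝓝 (f a)) := by
    intro a
    by_cases ha : a ∈ μ.support
    -- The density is the exponential of a difference of logarithms that vanishes at `t = 0`, so its
    -- derivative there is again `ν a`.
    · have h1 : HasDerivWithinAt (fun t : ℝ => Real.exp (Real.log (γ t a).toReal -
          Real.log (μ a).toReal)) (ν a) (Set.Ioi 0) 0 := by
        have := (((hderiv a ha).mono_of_mem_nhdsWithin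
          (Icc_mem_nhdsGT_of_mem ⟨le_rfl, one_pos⟩)).sub_const (Real.log (μ a).toReal)).exp
        simpa [hγ0] using this
      rw [hasDerivWithinAt_iff_tendsto_slope' (by simp)] at h1
      rw [hf, Set.indicator_of_mem ha]
      refine h1.congr' ?_
      filter_upwards [hIoc] with t ht
      rw [hφmem t a ha, slope_def_field, hγ0, sub_self, Real.exp_zero, sub_zero,
        ← Real.log_div (hpos _ (hsuppt t ht) a ha).ne' (hpos _ rfl a ha).ne', ← hexp t ht a ha]
    · simp only [hφnot _ a ha, hf, Set.indicator_of_notMem ha]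
      exact tendsto_const_nhds
  -- Differentiating the constant total mass: each `φ t` has mean `0`, and bounded convergence
  -- passes this to `f`.
  have hf0 : ∫ x, f x ∂μ.toMeasure = 0 := by
    have h1 : Tendsto (fun t => ∫ x, φ t x ∂μ.toMeasure) (𝓝[>] 0) (𝓝 (∫ x, f x ∂μ.toMeasure)) :=
      tendsto_integral_of_bounded μ (hIoc.mono hφM) hφlim
    refine tendsto_nhds_unique h1 (tendsto_const_nhds.congr' ?_)
    filter_upwards [hIoc] with t ht using (hφ0 t ht).symm
  have herr : Tendsto (fun t => √(∫ x, (φ t x - f x) ^ 2 ∂μ.toMeasure)) (𝓝[>] 0) (𝓝 0) := by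
    have h1 : Tendsto (fun t => ∫ x, (φ t x - f x) ^ 2 ∂μ.toMeasure) (𝓝[>] 0)
        (𝓝 (∫ _, 0 ∂μ.toMeasure)) := by
      refine tendsto_integral_of_bounded μ (C := (M + |C₁|) ^ 2) (hIoc.mono fun t ht a => ?_)
        fun a => ?_
      · rw [abs_pow]
        exact pow_le_pow_left₀ (abs_nonneg _)
          ((abs_sub _ _).trans (add_le_add (hφM t ht a) (hfC a))) 2
      · simpa using ((hφlim a).sub_const (f a)).pow 2
    simpa using h1.sqrt
  obtain ⟨σ, hσ⟩ := exists_tendsto_integral_dist_Z_mul_incSum hmom hdev hfC hf0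
  refine ⟨fun t ht => ⟨integrable_dist_Z (hmomt t ht), tendsto_meanDist_div (hmomt t ht)⟩,
    fun n => Integrable.congr ((memLp_dist_Z hmom n).integrable_mul (memLp_incSum hfC 2 n))
      (hae n), σ, ?_, ?_⟩
  · simpa only [integral_congr_ae (hae _)] using hσ
  obtain ⟨A, hA⟩ := exists_sqrt_variance_le hmom hdev
  obtain ⟨K, hK, τ, hτ⟩ := hunif
  -- `μ` lies in its own neighbourhood, so one `τ` serves both walks.
  have hμτ : DeviationWith 1 τ μ := hτ μ (mem_nhd_of_le_mul rfl zero_le_one (by simpa using hK.le)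
    (fun a _ => by simp) fun a _ => by simp)
  have hKt : ∀ᶠ t : ℝ in 𝓝[>] 0, Real.exp (t * D) - 1 ≤ K := by
    have hc : Continuous fun t : ℝ => Real.exp (t * D) - 1 := by fun_prop
    have h1 : Tendsto (fun t : ℝ => Real.exp (t * D) - 1) (𝓝[>] 0) (𝓝 0) := by
      simpa using (hc.tendsto 0).mono_left nhdsWithin_le_nhds
    exact (h1.eventually_lt_const hK).mono fun _ => le_of_lt
  have hsmall : ∀ᶠ t : ℝ in 𝓝[>] 0, horizon t * (t ^ 2 * M ^ 2) ≤ 1 := by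
    have h1 := tendsto_horizon_mul_sq.mul_const (M ^ 2)
    rw [zero_mul] at h1
    exact (h1.eventually_lt_const one_pos).mono fun t ht => by rw [← mul_assoc]; exact ht.le
  have hbound : Tendsto (fun t : ℝ => 4 * τ / (t * horizon t) + A * M ^ 2 * √(horizon t * t ^ 2) +
      A * √(∫ x, (φ t x - f x) ^ 2 ∂μ.toMeasure)) (𝓝[>] 0) (𝓝 0) := by
    have h1 := (tendsto_inv_mul_horizon.const_mul (4 * τ : ℝ)).add
      (tendsto_horizon_mul_sq.sqrt.const_mul (A * M ^ 2))
    simpa [div_eq_mul_inv] using h1.add (herr.const_mul A)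
  -- The normalised covariances tend to `σ` along the horizon, so it is enough that their distance
  -- to the slopes tends to `0`.
  refine (hσ.comp tendsto_horizon).congr_dist (squeeze_zero' (Eventually.of_forall fun _ =>
    dist_nonneg) ?_ hbound)
  filter_upwards [hIoc, hKt, hsmall, tendsto_horizon.eventually_ne_atTop 0] with t ht hKt hn hn0
  have hdevt : DeviationWith 1 τ (γ t) := hτ _ (mem_nhd_of_le_mul (hsuppt t ht)
    (Real.exp_pos _).le hKt (hle1 t ht) (hle2 t ht))
  rw [dist_comm, Real.dist_eq]
  exact abs_rateOfEscape_slope_sub_le hmom (hmomt t ⟨ht.1.le, ht.2⟩) (hsuppt t ht) hμτ hdevt hn0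
    (hA _) ht.1 (hφ1 t ht) (hφM t ht) hfC (hφ0 t ht) hf0 hn
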